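/- Let $N\ge 2$ be an integer, $q=e^{\pi i/N}$, and write $q^{x}=e^{\pi i x/N}$ for $x\in\frac12\mathbb Z$, $[k]=\frac{q^k-q^{-k}}{q-q^{-1}}$ and $[k]!=[k][k-1]\cdots[1]$. Let $\overline{\mathcal U}_q(sl_2)$ be the small quantum group, generated by $K^{\pm1},E,F$ with relations $KEK^{-1}=q^2E$, $KFK^{-1}=q^{-2}F$, $[E,F]=\frac{K-K^{-1}}{q-q^{-1}}$, $E^N=F^N=0$, $K^{2N}=1$. Let $\mu$ be its right integral, normalized by $$\mu(E^iF^mK^n)=-\sqrt{\tfrac2N}\,([N-1]!)^2\,\delta_{i,N-1}\,\delta_{m,N-1}\,\delta_{n,N+1}\qquad(0\le i,m\le N-1,\ 0\le n\le 2N-1),$$ and let $\phi$ be the symmetric linear function $\phi(x)=\mu(K^{N+1}x)$. Let $\mathcal A\supset\overline{\mathcal U}_q(sl_2)$ be the algebra generated by $e=E$, $f=F$ and an invertible element $k$ with $k^2=K$, $kek^{-1}=qe$, $kfk^{-1}=q^{-1}f$, $k^{4N}=1$, with universal $R$-matrix $$\overline R=\frac1{4N}\sum_{m=0}^{N-1}\sum_{n,j=0}^{4N-1}\frac{(q-q^{-1})^m}{[m]!}\,q^{m(m-1)/2+m(n-j)-nj/2}\,e^mk^n\otimes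 f^mk^j .$$ The universal invariant of a framed knot given by a closed braid diagram (with blackboard framing) is the product of the elements met when one walks once around the knot, where each positive crossing carries $\overline R$ and each negative crossing carries $\overline R^{-1}$ (first tensor factor on the over strand, second one on the under strand) and each closing arc carries $K^{1-N}$. Let $U_\pm$ be the unknot with framing $\pm1$, presented as the closure of the 2-strand braid with a single crossing of sign $\pm1$, and let $\psi_\phi(U_\pm)$ be the value of $\phi$ on its universal invariant. Then, for every choice of the base point of the walk, $|\psi_\phi(U_\pm)|=1$; in particular $\psi_\phi(U_\pm)\ne0$. Explicitly, $$\psi_\phi(U_+)=\frac{i^N\,q^{-3/2}}{2\sqrt{2N}}\;g_{4N},\qquad \psi_\phi(U_-)=\overline{\psi_\phi(U_+)},\qquad\text{where}\quad g_{4N}=\sum_{j=0}^{4N-1}q^{j^2/2}=2(1+i)\sqrt N .$$ -/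

import Mathlib

open scoped TensorProduct

namespace HenningsNormalization

/-- The power `q ^ x = exp (π i x / N)` of the root of unity `q = exp (π i / N)`;
half-integral exponents `x` are allowed. -/
noncomputable def qPow (N : ℕ) (x : ℂ) : ℂ :=
  Complex.exp (Real.pi * Complex.I * x / N)

/-- `{k} = q ^ k - q ^ (-k)`. -/
noncomputable def brace (N k : ℕ) : ℂ := qPow N k - qPow N (-k)

/-- The quantum integer `[k] = {k} / {1}`. -/
noncomputable def qInt (N k : ℕ) : ℂ := brace N k / brace N 1

/-- The quantum factorial `[k]! = [k] [k-1] ⋯ [1]`, with `[0]! = 1`. -/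
noncomputable def qFactorial (N k : ℕ) : ℂ := ∏ j ∈ Finset.range k, qInt N (j + 1)

/-! ### The two quantum groups -/

/-- Letters for the generators: the Cartan generator, its inverse, the raising and the
lowering generator. -/
inductive Gen : Type
  | K
  | Kinv
  | E
  | F

/-- The free associative algebra on the letters. -/
abbrev Free : Type := FreeAlgebra ℂ Gen

/-- A letter as an element of the free algebra. -/
abbrev gen (g : Gen) : Free := FreeAlgebra.ι ℂ g

/-- The defining relations of the small quantum group of `sl₂` at `q = exp (π i / N)`. -/
inductive SmallRel (N : ℕ) : Free → Free → Prop
  | K_mul_Kinv : SmallRel N (gen .K * gen .Kinv) 1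
  | Kinv_mul_K : SmallRel N (gen .Kinv * gen .K) 1
  | K_conj_E : SmallRel N (gen .K * gen .E * gen .Kinv) (qPow N 2 • gen .E)
  | K_conj_F : SmallRel N (gen .K * gen .F * gen .Kinv) (qPow N (-2) • gen .F)
  | E_comm_F : SmallRel N (gen .E * gen .F - gen .F * gen .E)
      ((qPow N 1 - qPow N (-1))⁻¹ • (gen .K - gen .Kinv))
  | E_pow : SmallRel N (gen .E ^ N) 0
  | F_pow : SmallRel N (gen .F ^ N) 0
  | K_pow : SmallRel N (gen .K ^ (2 * N)) 1

/-- The small quantum group of `sl₂`, as an associative algebra. -/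
abbrev SmallQG (N : ℕ) : Type := RingQuot (SmallRel N)

/-- A generator of the small quantum group. -/
noncomputable def SmallQG.gen (N : ℕ) (g : Gen) : SmallQG N :=
  RingQuot.mkAlgHom ℂ (SmallRel N) (HenningsNormalization.gen g)

/-- The defining relations of the extension of the small quantum group by a square root `k`
of its Cartan generator. -/
inductive ExtRel (N : ℕ) : Free → Free → Prop
  | k_mul_kinv : ExtRel N (gen .K * gen .Kinv) 1
  | kinv_mul_k : ExtRel N (gen .Kinv * gen .K) 1
  | k_conj_e : ExtRel N (gen .K * gen .E * gen .Kinv) (qPow N 1 • gen .E)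
  | k_conj_f : ExtRel N (gen .K * gen .F * gen .Kinv) (qPow N (-1) • gen .F)
  | e_comm_f : ExtRel N (gen .E * gen .F - gen .F * gen .E)
      ((qPow N 1 - qPow N (-1))⁻¹ • (gen .K ^ 2 - gen .Kinv ^ 2))
  | e_pow : ExtRel N (gen .E ^ N) 0
  | f_pow : ExtRel N (gen .F ^ N) 0
  | k_pow : ExtRel N (gen .K ^ (4 * N)) 1

/-- The algebra `𝒜` generated by `e`, `f`, `k`, in which the universal `R`-matrix lives. -/
abbrev ExtQG (N : ℕ) : Type := RingQuot (ExtRel N)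

/-- A generator of `𝒜`. -/
noncomputable def ExtQG.gen (N : ℕ) (g : Gen) : ExtQG N :=
  RingQuot.mkAlgHom ℂ (ExtRel N) (HenningsNormalization.gen g)

/-- The images in `𝒜` of the generators of the small quantum group:
`K ↦ k²`, `K⁻¹ ↦ k⁻²`, `E ↦ e`, `F ↦ f`. -/
noncomputable def inclGen (N : ℕ) : Gen → ExtQG N
  | .K => ExtQG.gen N .K ^ 2
  | .Kinv => ExtQG.gen N .Kinv ^ 2
  | .E => ExtQG.gen N .E
  | .F => ExtQG.gen N .F

theorem qPow_add (N : ℕ) (x y : ℂ) : qPow N (x + y) = qPow N x * qPow N y := by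
  unfold qPow
  rw [← Complex.exp_add]
  congr 1
  ring

theorem inclGen_rel (N : ℕ) ⦃x y : Free⦄ (h : SmallRel N x y) :
    FreeAlgebra.lift ℂ (inclGen N) x = FreeAlgebra.lift ℂ (inclGen N) y := by
  have r : ∀ {a b : Free}, ExtRel N a b →
      RingQuot.mkAlgHom ℂ (ExtRel N) a = RingQuot.mkAlgHom ℂ (ExtRel N) b :=
    fun hab => RingQuot.mkAlgHom_rel ℂ hab
  have h1 : ExtQG.gen N .K * ExtQG.gen N .Kinv = 1 := by
    simpa [ExtQG.gen] using r (ExtRel.k_mul_kinv (N := N))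
  have h2 : ExtQG.gen N .Kinv * ExtQG.gen N .K = 1 := by
    simpa [ExtQG.gen] using r (ExtRel.kinv_mul_k (N := N))
  have h3 : ExtQG.gen N .K * ExtQG.gen N .E * ExtQG.gen N .Kinv = qPow N 1 • ExtQG.gen N .E := by
    simpa [ExtQG.gen] using r (ExtRel.k_conj_e (N := N))
  have h4 : ExtQG.gen N .K * ExtQG.gen N .F * ExtQG.gen N .Kinv = qPow N (-1) • ExtQG.gen N .F := by
    simpa [ExtQG.gen] using r (ExtRel.k_conj_f (N := N))
  have h5 : ExtQG.gen N .E * ExtQG.gen N .F - ExtQG.gen N .F * ExtQG.gen N .E =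
      (qPow N 1 - qPow N (-1))⁻¹ • (ExtQG.gen N .K ^ 2 - ExtQG.gen N .Kinv ^ 2) := by
    simpa [ExtQG.gen] using r (ExtRel.e_comm_f (N := N))
  have h6 : ExtQG.gen N .E ^ N = 0 := by
    simpa [ExtQG.gen] using r (ExtRel.e_pow (N := N))
  have h7 : ExtQG.gen N .F ^ N = 0 := by
    simpa [ExtQG.gen] using r (ExtRel.f_pow (N := N))
  have h8 : ExtQG.gen N .K ^ (4 * N) = 1 := by
    simpa [ExtQG.gen] using r (ExtRel.k_pow (N := N))
  have key : ∀ (a : ExtQG N) (c : ℂ), ExtQG.gen N .K * a * ExtQG.gen N .Kinv = c • a →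
      ExtQG.gen N .K ^ 2 * a * ExtQG.gen N .Kinv ^ 2 = (c * c) • a := by
    intro a c hc
    have : ExtQG.gen N .K ^ 2 * a * ExtQG.gen N .Kinv ^ 2 =
        ExtQG.gen N .K * (ExtQG.gen N .K * a * ExtQG.gen N .Kinv) * ExtQG.gen N .Kinv := by
      simp only [pow_two, mul_assoc]
    rw [this, hc, mul_smul_comm, smul_mul_assoc, hc, smul_smul]
  have e2 : qPow N 2 = qPow N 1 * qPow N 1 := by rw [← qPow_add]; norm_num
  have e3 : qPow N (-2) = qPow N (-1) * qPow N (-1) := by rw [← qPow_add]; norm_num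
  have cancel : ∀ a b : ExtQG N, a * b = 1 → a ^ 2 * b ^ 2 = 1 := by
    intro a b hab
    calc a ^ 2 * b ^ 2 = a * (a * b) * b := by simp only [pow_two, mul_assoc]
      _ = 1 := by rw [hab, mul_one, hab]
  cases h with
  | K_mul_Kinv => simpa [inclGen] using cancel _ _ h1
  | Kinv_mul_K => simpa [inclGen] using cancel _ _ h2
  | K_conj_E => simpa [inclGen, e2] using key _ _ h3
  | K_conj_F => simpa [inclGen, e3] using key _ _ h4
  | E_comm_F => simpa [inclGen] using h5
  | E_pow => simpa [inclGen] using h6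
  | F_pow => simpa [inclGen] using h7
  | K_pow =>
    have : ExtQG.gen N .K ^ (2 * (2 * N)) = 1 := by rw [← h8]; congr 1; ring
    simpa [inclGen, ← pow_mul] using this

/-- The inclusion `ι` of the small quantum group into `𝒜`. -/
noncomputable def incl (N : ℕ) : SmallQG N →ₐ[ℂ] ExtQG N :=
  RingQuot.liftAlgHom ℂ ⟨FreeAlgebra.lift ℂ (inclGen N), inclGen_rel N⟩

/-! ### The right integral and the symmetric linear function -/

/-- The normalization factor `ζ = - √(2 / N) ([N-1]!)²`. -/
noncomputable def zeta (N : ℕ) : ℂ :=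
  -(Real.sqrt (2 / N) : ℂ) * qFactorial N (N - 1) ^ 2

/-- `μ` is the right integral normalized by `ζ`: on the basis `Eⁱ Fᵐ Kⁿ`
(`0 ≤ i, m ≤ N - 1`, `0 ≤ n ≤ 2N - 1`) it takes the value `ζ` at `E^(N-1) F^(N-1) K^(N+1)`
and `0` at all other basis elements. -/
def IsRightIntegral (N : ℕ) (μ : SmallQG N →ₗ[ℂ] ℂ) : Prop :=
  ∀ i < N, ∀ m < N, ∀ n < 2 * N,
    μ (SmallQG.gen N .E ^ i * SmallQG.gen N .F ^ m * SmallQG.gen N .K ^ n) =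
      if i = N - 1 ∧ m = N - 1 ∧ n = N + 1 then zeta N else 0

open Classical in
/-- The normalized right integral (there is exactly one for `2 ≤ N`). -/
noncomputable def rightIntegral (N : ℕ) : SmallQG N →ₗ[ℂ] ℂ :=
  if h : ∃ μ, IsRightIntegral N μ then h.choose else 0

/-- The symmetric linear function `φ (x) = μ (K^(N+1) x)`. -/
noncomputable def phi (N : ℕ) (x : SmallQG N) : ℂ :=
  rightIntegral N (SmallQG.gen N .K ^ (N + 1) * x)

/-! ### The universal `R`-matrix -/

/-- The universal `R`-matrix `∑ a ⊗ b` in `𝒜 ⊗ 𝒜`. -/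
noncomputable def rMatrix (N : ℕ) : ExtQG N ⊗[ℂ] ExtQG N :=
  (1 / (4 * N) : ℂ) • ∑ m ∈ Finset.range N, ∑ n ∈ Finset.range (4 * N),
    ∑ j ∈ Finset.range (4 * N),
      (brace N 1 ^ m / qFactorial N m *
        qPow N ((m : ℂ) * (m - 1) / 2 + m * (n - j) - n * j / 2)) •
      ((ExtQG.gen N .E ^ m * ExtQG.gen N .K ^ n) ⊗ₜ[ℂ] (ExtQG.gen N .F ^ m * ExtQG.gen N .K ^ j))

/-- The inverse `∑ a' ⊗ b'` of the universal `R`-matrix in the algebra `𝒜 ⊗ 𝒜`. -/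
noncomputable def rMatrixInv (N : ℕ) : ExtQG N ⊗[ℂ] ExtQG N := Ring.inverse (rMatrix N)

/-! ### Closed braid diagrams of knots -/

/-- A word in the braid generators on `n + 1` strands, read from top to bottom, the strands
running downwards. A letter `(i, true)` is a positive crossing of the strands at positions
`i` and `i + 1` (the strand running from upper right to lower left is the over strand), and
`(i, false)` is a negative one (the strand running from upper left to lower right is the
over strand). -/
abbrev BraidWord (n : ℕ) : Type := List (Fin n × Bool)

/-- The permutation of a braid word: the strand that starts at the top position `p` ends at
the bottom position `braidPerm w p`. -/
def braidPerm {n : ℕ} (w : BraidWord n) : Equiv.Perm (Fin (n + 1)) :=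
  w.foldl (fun π c => Equiv.swap c.1.castSucc c.1.succ * π) 1

/-- A braid word whose closure has one component, that is, whose permutation is a cycle
through all the positions. Its closure is a diagram of an oriented knot, framed by the
blackboard framing, so that the framing number is the writhe of the word. -/
structure KnotDiagram (n : ℕ) where
  /-- the braid word -/
  word : BraidWord n
  /-- travelling along the closure from any top position, one passes every position once -/
  bijective : ∀ x : Fin (n + 1),
    Function.Bijective fun k : Fin (n + 1) => (braidPerm word ^ (k.val + 1)) x

/-- The framing number of the blackboard framing: the signed number of crossings. -/
def KnotDiagram.framing {n : ℕ} (D : KnotDiagram n) : ℤ :=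
  (D.word.map fun c => if c.2 then (1 : ℤ) else -1).sum

/-- The diagram of the unknot `U₊` with framing `+1` (for `true`) and of the unknot `U₋` with
framing `-1` (for `false`): the closure of the braid on two strands with one crossing. -/
def unknot (s : Bool) : KnotDiagram 1 where
  word := [(0, s)]
  bijective := by
    intro x
    rw [← Finite.injective_iff_bijective]
    revert x s
    decide

/-! ### The universal invariant -/

/-- The tensor power of `𝒜` with one factor for each of the `n + 1` positions. -/
abbrev TensorPow (N n : ℕ) : Type := PiTensorProduct ℂ fun _ : Fin (n + 1) => ExtQG N

/-- `a ⊗ b ↦` the element with `a` in the factor `i`, `b` in the factor `j` and `1` in the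
other factors. -/
noncomputable def place (N n : ℕ) (i j : Fin (n + 1)) :
    ExtQG N ⊗[ℂ] ExtQG N →ₗ[ℂ] TensorPow N n :=
  TensorProduct.lift
    (PiTensorProduct.mul.compl₁₂
      (PiTensorProduct.singleAlgHom (R := ℂ) (A := fun _ : Fin (n + 1) => ExtQG N) i).toLinearMap
      (PiTensorProduct.singleAlgHom (R := ℂ) (A := fun _ : Fin (n + 1) => ExtQG N) j).toLinearMap)

/-- Permutation of the factors: the factor at `p` is moved to `σ p`. -/
noncomputable def permute (N n : ℕ) (σ : Equiv.Perm (Fin (n + 1))) :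
    TensorPow N n →ₗ[ℂ] TensorPow N n :=
  (PiTensorProduct.reindex ℂ (fun _ : Fin (n + 1) => ExtQG N) σ).toLinearMap

/-- The effect of one crossing: the strands change places, and then each of the two meets its
factor of `R` or of `R⁻¹`, the over strand the first and the under strand the second one. -/
noncomputable def crossing (N n : ℕ) (u : TensorPow N n) (c : Fin n × Bool) : TensorPow N n :=
  permute N n (Equiv.swap c.1.castSucc c.1.succ) u *
    if c.2 then place N n c.1.castSucc c.1.succ (rMatrix N)
    else place N n c.1.succ c.1.castSucc (rMatrixInv N)

/-- The universal invariant of the open braid: the factor at `p` is the product of the elements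
met along the strand that ends at the bottom position `p`, in the order of its orientation. -/
noncomputable def braidInvariant (N n : ℕ) (w : BraidWord n) : TensorPow N n :=
  w.foldl (crossing N n) 1

/-- The element `K^(1-N) = k^(2(1-N))`, written with the inverse generator; it is assigned to
each of the arcs that close the braid. -/
noncomputable def closingElement (N : ℕ) : ExtQG N := ExtQG.gen N .Kinv ^ (2 * (N - 1))

/-- The product of the elements met on a walk once around the closure of the braid, along its
orientation, from the top of the strand at position `x`: the beads of the first strand, the
element of its closing arc, the beads of the second strand, and so on. -/
noncomputable def walkProduct (N : ℕ) {n : ℕ} (D : KnotDiagram n) (x : Fin (n + 1)) :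
    TensorPow N n →ₗ[ℂ] ExtQG N :=
  PiTensorProduct.lift
    (((MultilinearMap.mkPiAlgebraFin ℂ (n + 1) (ExtQG N)).compLinearMap
        fun _ => LinearMap.mulRight ℂ (closingElement N)).domDomCongr
      (Equiv.ofBijective _ (D.bijective x)))

/-- The element `Ψₓ` of `𝒜` of the closed braid diagram `D` with base point `x`. -/
noncomputable def universalExt (N : ℕ) {n : ℕ} (D : KnotDiagram n) (x : Fin (n + 1)) : ExtQG N :=
  walkProduct N D x (braidInvariant N n D.word)

open Classical in
/-- `Ψₓ`, which lies in the image of the inclusion `ι`, as an element of the small quantum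
group. -/
noncomputable def universal (N : ℕ) {n : ℕ} (D : KnotDiagram n) (x : Fin (n + 1)) : SmallQG N :=
  if h : ∃ u : SmallQG N, incl N u = universalExt N D x then h.choose else 0

/-- `ψ_φ`: the symmetric linear function `φ` applied to the universal invariant, computed with
the base point `x`. -/
noncomputable def psiPhi (N : ℕ) {n : ℕ} (D : KnotDiagram n) (x : Fin (n + 1)) : ℂ :=
  phi N (universal N D x)

/-- The quadratic Gauss sum `∑ q^(j² / 2)` over `0 ≤ j < 4N`. -/
noncomputable def quadraticGaussSum (N : ℕ) : ℂ := ∑ j ∈ Finset.range (4 * N), qPow N ((j : ℂ) ^ 2 / 2)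

end HenningsNormalization

/-!
The value `ψ_φ(U_±)` is a normalized quadratic Gauss sum, for the following reasons.

The algebra `𝒜 = ExtQG N` acts on the space spanned by the monomials `eⁱ fᵐ kⁿ` as on itself by
left multiplication. That the operators written down on this space satisfy the defining relations
is a direct check, except for `fᴺ = 0`, which follows since `fᴺ` commutes with `e` (as `[N] = 0`)
and kills the monomials without `e`. Reading off `ζ` times the coefficient of `e^(N-1) f^(N-1)
k^(2N+2)` in `x · 1` gives a linear form `extIntegral` on `𝒜` that restricts to the right integral
`μ`; since the monomials span the small quantum group, `μ` is unique and `φ(u) = extIntegral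
(k^(2N+2) ι(u))` (`phi_eq`). This also makes `φ(u)` independent of the choice of `u` with given
image in `𝒜`.

The universal `R`-matrix is `D Θ`, with `D` a Cartan part and `Θ` the quantum exponential of the
nilpotent element `e ⊗ f`. The element `D` is inverted through the eigenprojections of `k ⊗ 1`
(`cartanPart_mul_cartanPart_inv`), and `Θ` through a telescoping identity of coefficients
(`sum_antidiagonal_qExpCoeff`), so that `R⁻¹ = Θ⁻¹ D⁻¹` is as explicit as `R`
(`rMatrixInv_eq_tensorSum`).

For all four combinations of sign and base point, the universal invariant of `U_±` then has the
form `∑ G(m, n, j) M_m k^(n+j+4)`, where `M_m` is `e^m f^m` or `f^m e^m`, and `G` is a factor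
depending only on `m` times a power of `q` with quadratic exponent. A shift of `(n, j)` by `(2N,
-2N)` multiplies the terms by `(-1)^(n+j)`, so the odd powers of `k` cancel and the invariant lies
in the small quantum group (`sum_quadCoeff_mem_range_incl`). The integral leaves the terms with `m
= N - 1` and `n + j + 4 ≡ 0` modulo `4N`; completing the square turns their sum into the Gauss
sum, and the evaluation `{1} {2} ⋯ {N-1} = i^(N-1) N` gives the factor in front of it.

The Gauss sum is evaluated, including its sign, through the Jacobi theta function near the cusp `1
/ (2N)`: the theta series splits into residue classes modulo `2N`, each with a known asymptotic
behaviour, while two inversions and a translation by `2N` move the cusp to `i ∞`, where the theta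
function tends to `1` (`cpow_mul_sum_cosKernel`, `sum_fin_qPow_sq`).
-/

namespace HenningsNormalization

/-! ### Powers of the root of unity and quantum integers -/

theorem qPow_zero (N : ℕ) : qPow N 0 = 1 := by simp [qPow]

theorem qPow_ne_zero (N : ℕ) (x : ℂ) : qPow N x ≠ 0 := Complex.exp_ne_zero _

theorem qPow_neg (N : ℕ) (x : ℂ) : qPow N (-x) = (qPow N x)⁻¹ := by
  rw [qPow, qPow, ← Complex.exp_neg]
  congr 1
  ring

theorem qPow_pow (N : ℕ) (x : ℂ) (n : ℕ) : qPow N x ^ n = qPow N (n * x) := by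
  rw [qPow, qPow, ← Complex.exp_nat_mul]
  congr 1
  ring

theorem qPow_zpow (N : ℕ) (x : ℂ) (n : ℤ) : qPow N x ^ n = qPow N (n * x) := by
  rw [qPow, qPow, ← Complex.exp_int_mul]
  congr 1
  ring

theorem qPow_two_mul_mul {N : ℕ} (hN : N ≠ 0) (z : ℤ) : qPow N (2 * N * z) = 1 := by
  rw [qPow, Complex.exp_eq_one_iff]
  refine ⟨z, ?_⟩
  have : (N : ℂ) ≠ 0 := by exact_mod_cast hN
  field_simp

/-- The powers of `q` depend only on the exponent modulo `2 N`. -/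
theorem qPow_congr {N : ℕ} (hN : N ≠ 0) {x y : ℂ} (z : ℤ) (h : x = y + 2 * N * z) :
    qPow N x = qPow N y := by
  rw [h, qPow_add, qPow_two_mul_mul hN, mul_one]

theorem qPow_natCast_self {N : ℕ} (hN : N ≠ 0) : qPow N N = -1 := by
  have : (N : ℂ) ≠ 0 := by exact_mod_cast hN
  rw [qPow, mul_div_assoc, div_self this, mul_one, Complex.exp_pi_mul_I]

theorem qPow_neg_half_self {N : ℕ} (hN : N ≠ 0) : qPow N (-(N / 2)) = -Complex.I := by
  have : (N : ℂ) ≠ 0 := by exact_mod_cast hN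
  have e : (Real.pi * Complex.I * -(N / 2) / N : ℂ) = -(Real.pi / 2 * Complex.I) := by
    field_simp
  rw [qPow, e, Complex.exp_neg, Complex.exp_pi_div_two_mul_I, Complex.inv_I]

theorem conj_qPow (N : ℕ) (x : ℝ) : (starRingEnd ℂ) (qPow N x) = qPow N (-x) := by
  rw [qPow, qPow, ← Complex.exp_conj]
  congr 1
  simp

theorem norm_qPow (N : ℕ) (x : ℝ) : ‖qPow N x‖ = 1 := by
  have : (Real.pi * Complex.I * x / N : ℂ) = ((Real.pi * x / N : ℝ) : ℂ) * Complex.I := by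
    push_cast
    ring
  rw [qPow, this, Complex.norm_exp_ofReal_mul_I]

theorem isPrimitiveRoot_qPow_two {N : ℕ} (hN : N ≠ 0) : IsPrimitiveRoot (qPow N 2) N := by
  have := Complex.isPrimitiveRoot_exp N hN
  rwa [show 2 * (Real.pi : ℂ) * Complex.I / N = Real.pi * Complex.I * 2 / N by ring] at this

theorem isPrimitiveRoot_qPow_half {N : ℕ} (hN : N ≠ 0) :
    IsPrimitiveRoot (qPow N (1 / 2)) (4 * N) := by
  have := Complex.isPrimitiveRoot_exp (4 * N) (by omega)
  rwa [show 2 * (Real.pi : ℂ) * Complex.I / (4 * N : ℕ) = Real.pi * Complex.I * (1 / 2) / N by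
    push_cast
    have : (N : ℂ) ≠ 0 := by exact_mod_cast hN
    field_simp
    norm_num] at this

theorem brace_eq (N k : ℕ) : brace N k = -(qPow N (-k) * (1 - qPow N 2 ^ k)) := by
  rw [brace, qPow_pow, mul_sub, ← qPow_add]
  ring_nf

theorem brace_ne_zero {N k : ℕ} (hk : 0 < k) (hkN : k < N) : brace N k ≠ 0 := by
  rw [brace_eq]
  refine neg_ne_zero.2 (mul_ne_zero (qPow_ne_zero _ _) (sub_ne_zero.2 ?_))
  exact ((isPrimitiveRoot_qPow_two (by omega)).pow_ne_one_of_pos_of_lt hk.ne' hkN).symm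

theorem brace_self {N : ℕ} (hN : N ≠ 0) : brace N N = 0 := by
  rw [brace, qPow_neg, qPow_natCast_self hN]
  norm_num

theorem brace_zero (N : ℕ) : brace N 0 = 0 := by simp [brace]

theorem qFactorial_succ (N k : ℕ) : qFactorial N (k + 1) = qFactorial N k * qInt N (k + 1) :=
  Finset.prod_range_succ _ _

theorem qFactorial_ne_zero {N k : ℕ} (hN : 2 ≤ N) (hk : k < N) : qFactorial N k ≠ 0 :=
  Finset.prod_ne_zero_iff.2 fun j hj => div_ne_zero
    (brace_ne_zero j.succ_pos (by have := Finset.mem_range.1 hj; omega))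
    (brace_ne_zero one_pos hN)

theorem brace_pow_mul_qFactorial {N : ℕ} (hN : 2 ≤ N) (k : ℕ) :
    brace N 1 ^ k * qFactorial N k = ∏ j ∈ Finset.range k, brace N (j + 1) := by
  rw [qFactorial, ← Finset.card_range k, ← Finset.prod_const, Finset.card_range,
    ← Finset.prod_mul_distrib]
  refine Finset.prod_congr rfl fun j _ => ?_
  rw [qInt, mul_div_cancel₀ _ (brace_ne_zero one_pos hN)]

/-- The product `{1} {2} ⋯ {N-1}` is `i^(N-1) N`, by the evaluation of the cyclotomic product
`∏ (1 - q^(2j))`. -/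
theorem prod_brace {N : ℕ} (hN : N ≠ 0) :
    ∏ j ∈ Finset.range (N - 1), brace N (j + 1) = Complex.I ^ (N - 1) * N := by
  obtain ⟨M, rfl⟩ := Nat.exists_eq_succ_of_ne_zero hN
  have hp := (isPrimitiveRoot_qPow_two hN).prod_one_sub_pow_eq_order
  have hM : ((M + 1 : ℕ) : ℂ) ≠ 0 := by exact_mod_cast hN
  have key : ∀ k : ℕ, ∏ j ∈ Finset.range k, -qPow (M + 1) (-((j + 1 : ℕ) : ℂ)) =
      (-1) ^ k * qPow (M + 1) (-((k : ℂ) * (k + 1) / 2)) := by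
    intro k
    induction k with
    | zero => simp [qPow_zero]
    | succ k ih =>
      rw [Finset.prod_range_succ, ih, mul_neg, mul_assoc, ← qPow_add, pow_succ, mul_neg_one,
        neg_mul]
      congr 3
      push_cast
      ring
  have e : qPow (M + 1) (-((M : ℂ) * (M + 1) / 2)) = (-Complex.I) ^ M := by
    rw [← qPow_neg_half_self hN, qPow_pow]
    congr 1
    push_cast
    ring
  simp only [Nat.succ_eq_add_one, Nat.add_sub_cancel, brace_eq, ← neg_mul] at hp ⊢
  rw [Finset.prod_mul_distrib, key, hp, e, ← mul_pow]
  push_cast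
  ring

/-! ### Sums over a period -/

theorem sum_range_periodic_add_nat {M : Type*} [AddCommGroup M] {c : ℕ} {f : ℤ → M}
    (hf : Function.Periodic f c) (d : ℕ) :
    ∑ j ∈ Finset.range c, f (j + d) = ∑ j ∈ Finset.range c, f j := by
  induction d with
  | zero => simp
  | succ d ih =>
    rw [← ih]
    have h1 := Finset.sum_range_succ (fun j : ℕ => f (j + d)) c
    have h2 := Finset.sum_range_succ' (fun j : ℕ => f (j + d)) c
    have h3 : f (c + d) = f ((0 : ℕ) + d) := by
      rw [add_comm, hf]
      simp
    rw [h2, h3] at h1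
    have := add_right_cancel h1
    rw [← this]
    refine Finset.sum_congr rfl fun j _ => ?_
    push_cast
    ring_nf

theorem sum_range_periodic_add {M : Type*} [AddCommGroup M] {c : ℕ} {f : ℤ → M}
    (hf : Function.Periodic f c) (d : ℤ) :
    ∑ j ∈ Finset.range c, f (j + d) = ∑ j ∈ Finset.range c, f j := by
  obtain ⟨n, rfl | rfl⟩ := d.eq_nat_or_neg
  · exact sum_range_periodic_add_nat hf n
  · have hg : Function.Periodic (fun j => f (j + -n)) c := fun j => by
      change f (j + c + -n) = f (j + -n)
      rw [add_right_comm, hf]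
    rw [← sum_range_periodic_add_nat hg n]
    simp

theorem sum_range_periodic_neg {M : Type*} [AddCommGroup M] {c : ℕ} {f : ℤ → M}
    (hf : Function.Periodic f c) :
    ∑ j ∈ Finset.range c, f (-j) = ∑ j ∈ Finset.range c, f j := by
  rw [← Finset.sum_range_reflect, ← sum_range_periodic_add hf (1 - c)]
  refine Finset.sum_congr rfl fun j hj => ?_
  have : j < c := Finset.mem_range.1 hj
  congr 1
  omega

theorem sum_range_periodic_ite {M : Type*} [AddCommGroup M] {c : ℕ} (hc : c ≠ 0) {f : ℤ → M}
    (hf : Function.Periodic f c) (a : ℤ) :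
    (∑ j ∈ Finset.range c, if (c : ℤ) ∣ j - a then f j else 0) = f a := by
  have hc' : (c : ℤ) ≠ 0 := by exact_mod_cast hc
  have h0 := Int.emod_nonneg a hc'
  have h1 := Int.emod_lt_of_pos a (b := c) (by omega)
  have h2 : ((a % c).toNat : ℤ) = a % c := Int.toNat_of_nonneg h0
  rw [Finset.sum_eq_single (a % c).toNat]
  · rw [h2, if_pos Int.dvd_emod_sub_self, Int.emod_def, mul_comm]
    exact hf.sub_int_mul_eq _
  · intro j hj hne
    rw [if_neg]
    intro hd
    have hj' := Finset.mem_range.1 hj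
    have : a % c = j := by
      rw [← Int.emod_eq_of_lt (a := (j : ℤ)) (b := c) (by omega) (by omega)]
      exact (Int.emod_eq_emod_iff_emod_sub_eq_zero.2 (Int.emod_eq_zero_of_dvd hd)).symm
    omega
  · intro h
    exact absurd (Finset.mem_range.2 (by omega)) h

/-- Orthogonality of the characters of the cyclic group of order `4 N`. -/
theorem sum_qPow_half {N : ℕ} (hN : N ≠ 0) (l : ℤ) :
    ∑ n ∈ Finset.range (4 * N), qPow N (n * l / 2) =
      if ((4 * N : ℕ) : ℤ) ∣ l then (4 * N : ℂ) else 0 := by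
  have hω := isPrimitiveRoot_qPow_half hN
  have e : ∀ n : ℕ, qPow N (n * l / 2) = (qPow N (1 / 2) ^ l) ^ n := fun n => by
    rw [qPow_zpow, qPow_pow]
    ring_nf
  simp only [e]
  split_ifs with h
  · rw [(hω.zpow_eq_one_iff_dvd l).2 h]
    simp
  · have hne : qPow N (1 / 2) ^ l ≠ 1 := fun h' => h ((hω.zpow_eq_one_iff_dvd l).1 h')
    rw [geom_sum_eq hne, ← zpow_natCast, ← zpow_mul, mul_comm, zpow_mul, zpow_natCast,
      hω.pow_eq_one, one_zpow, sub_self, zero_div]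

/-! ### Consequences of the defining relations -/

/-- The commutator of `e` with the powers of `f`, in any algebra with elements that satisfy the
relations of `e`, `f`, `k` and `l = k⁻¹`. -/
theorem mul_pow_succ_eq_pow_succ_mul_add {A : Type*} [Ring A] [Algebra ℂ A] {N : ℕ} (hN : 2 ≤ N)
    {e f k l : A} (hk : k ^ 2 * f = qPow N (-2) • (f * k ^ 2))
    (hl : l ^ 2 * f = qPow N 2 • (f * l ^ 2))
    (hef : e * f - f * e = (qPow N 1 - qPow N (-1))⁻¹ • (k ^ 2 - l ^ 2)) (r : ℕ) :
    e * f ^ (r + 1) = f ^ (r + 1) * e + (brace N (r + 1) / brace N 1 ^ 2) •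
      (f ^ r * (qPow N (-r) • k ^ 2 - qPow N r • l ^ 2)) := by
  have hb : brace N 1 = qPow N 1 - qPow N (-1) := by simp [brace]
  have hb0 : brace N 1 ≠ 0 := brace_ne_zero one_pos hN
  rw [← hb, sub_eq_iff_eq_add'] at hef
  induction r with
  | zero =>
    have : brace N 1 / brace N 1 ^ 2 = (brace N 1)⁻¹ := by field_simp
    simp [hef, qPow_zero, this]
  | succ r ih =>
    rw [pow_succ f (r + 1), ← mul_assoc, ih, add_mul, mul_assoc, hef, smul_mul_assoc, mul_assoc,
      sub_mul, smul_mul_assoc, smul_mul_assoc, hk, hl]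
    simp only [mul_add, mul_sub, mul_smul_comm, smul_smul, ← mul_assoc, ← pow_succ, smul_sub]
    have h1 : (brace N 1)⁻¹ + brace N (r + 1) / brace N 1 ^ 2 * (qPow N (-r) * qPow N (-2)) =
        brace N (r + 1 + 1) / brace N 1 ^ 2 * qPow N (-(r + 1 : ℕ)) := by
      rw [inv_eq_one_div]
      field_simp
      simp only [brace, sub_mul, ← qPow_add]
      push_cast
      ring_nf
    have h2 : (brace N 1)⁻¹ + brace N (r + 1) / brace N 1 ^ 2 * (qPow N r * qPow N 2) =
        brace N (r + 1 + 1) / brace N 1 ^ 2 * qPow N (r + 1 : ℕ) := by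
      rw [inv_eq_one_div]
      field_simp
      simp only [brace, sub_mul, ← qPow_add]
      push_cast
      ring_nf
    rw [← h1, ← h2]
    module

/-! ### A module over the extended quantum group -/

/-- The vector space with basis the monomials `eⁱ fᵐ kⁿ`, where `i, m < N` and `n` is taken
modulo `4 N`. -/
abbrev MonomialSpace (N : ℕ) : Type := Fin N × Fin N × ZMod (4 * N) →₀ ℂ

/-- The basis vector of the monomial `eⁱ fᵐ kⁿ`; it is `0` if `N ≤ i` or `N ≤ m`, where the
monomial vanishes. -/
noncomputable def monomialVec (N i m : ℕ) (n : ZMod (4 * N)) : MonomialSpace N :=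
  if h : i < N ∧ m < N then Finsupp.single (⟨i, h.1⟩, ⟨m, h.2⟩, n) 1 else 0

theorem monomialVec_of_le_left {N i : ℕ} (m : ℕ) (n : ZMod (4 * N)) (h : N ≤ i) :
    monomialVec N i m n = 0 := dif_neg (by omega)

theorem monomialVec_of_le_right {N m : ℕ} (i : ℕ) (n : ZMod (4 * N)) (h : N ≤ m) :
    monomialVec N i m n = 0 := dif_neg (by omega)

theorem monomialSpace_hom_ext {N : ℕ} {M : Type*} [AddCommMonoid M] [Module ℂ M]
    {f g : MonomialSpace N →ₗ[ℂ] M}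
    (h : ∀ i m n, f (monomialVec N i m n) = g (monomialVec N i m n)) : f = g := by
  refine Finsupp.lhom_ext' fun ⟨i, m, n⟩ => LinearMap.ext_ring ?_
  have := h i m n
  rwa [monomialVec, dif_pos ⟨i.2, m.2⟩] at this

/-- The linear map with prescribed values on the basis vectors. -/
noncomputable def onMonomials {N : ℕ} (φ : ℕ → ℕ → ZMod (4 * N) → MonomialSpace N) :
    Module.End ℂ (MonomialSpace N) :=
  Finsupp.linearCombination ℂ fun p => φ p.1 p.2.1 p.2.2

theorem onMonomials_monomialVec {N : ℕ} {φ : ℕ → ℕ → ZMod (4 * N) → MonomialSpace N}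
    (h : ∀ i m n, N ≤ i ∨ N ≤ m → φ i m n = 0) (i m : ℕ) (n : ZMod (4 * N)) :
    onMonomials φ (monomialVec N i m n) = φ i m n := by
  rw [monomialVec]
  split_ifs with hi
  · simp [onMonomials]
  · rw [map_zero, h i m n (by omega)]

/-- Left multiplication by `e` on monomials. -/
noncomputable def eAct (N : ℕ) : Module.End ℂ (MonomialSpace N) :=
  onMonomials fun i m n => monomialVec N (i + 1) m n

/-- Left multiplication by `k` on monomials. -/
noncomputable def kAct (N : ℕ) : Module.End ℂ (MonomialSpace N) :=
  onMonomials fun i m n => qPow N (i - m) • monomialVec N i m (n + 1)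

/-- Left multiplication by `k⁻¹` on monomials. -/
noncomputable def kinvAct (N : ℕ) : Module.End ℂ (MonomialSpace N) :=
  onMonomials fun i m n => qPow N (m - i) • monomialVec N i m (n - 1)

/-- Left multiplication by `f` on monomials, from
`f eⁱ = eⁱ f - [i] / {1} e^(i-1) (q^(i-1) k² - q^(1-i) k⁻²)`. At `i = 0` the truncated `i - 1` is
harmless, since `{0} = 0`. -/
noncomputable def fAct (N : ℕ) : Module.End ℂ (MonomialSpace N) :=
  onMonomials fun i m n => monomialVec N i (m + 1) n - (brace N i / brace N 1 ^ 2) •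
    (qPow N ((i : ℂ) - 1 - 2 * m) • monomialVec N (i - 1) m (n + 2) -
      qPow N (-((i : ℂ) - 1 - 2 * m)) • monomialVec N (i - 1) m (n - 2))

theorem eAct_monomialVec (N i m : ℕ) (n : ZMod (4 * N)) :
    eAct N (monomialVec N i m n) = monomialVec N (i + 1) m n := by
  refine onMonomials_monomialVec (fun i m n h => ?_) i m n
  rw [monomialVec, dif_neg (by omega)]

theorem kAct_monomialVec (N i m : ℕ) (n : ZMod (4 * N)) :
    kAct N (monomialVec N i m n) = qPow N (i - m) • monomialVec N i m (n + 1) := by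
  refine onMonomials_monomialVec (fun i m n h => ?_) i m n
  rw [monomialVec, dif_neg (by omega), smul_zero]

theorem kinvAct_monomialVec (N i m : ℕ) (n : ZMod (4 * N)) :
    kinvAct N (monomialVec N i m n) = qPow N (m - i) • monomialVec N i m (n - 1) := by
  refine onMonomials_monomialVec (fun i m n h => ?_) i m n
  rw [monomialVec, dif_neg (by omega), smul_zero]

theorem fAct_monomialVec {N : ℕ} (hN : N ≠ 0) (i m : ℕ) (n : ZMod (4 * N)) :
    fAct N (monomialVec N i m n) = monomialVec N i (m + 1) n - (brace N i / brace N 1 ^ 2) •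
      (qPow N ((i : ℂ) - 1 - 2 * m) • monomialVec N (i - 1) m (n + 2) -
        qPow N (-((i : ℂ) - 1 - 2 * m)) • monomialVec N (i - 1) m (n - 2)) := by
  refine onMonomials_monomialVec (fun i m n h => ?_) i m n
  rw [monomialVec, dif_neg (by omega), zero_sub, neg_eq_zero]
  -- for `i = N` the coefficient `{N}` vanishes, in all other cases the vectors do
  rcases eq_or_ne i N with rfl | hi
  · rw [brace_self hN, zero_div, zero_smul]
  · rw [monomialVec, monomialVec, dif_neg (by omega), dif_neg (by omega), smul_zero, smul_zero,
      sub_zero, smul_zero]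

theorem fAct_monomialVec_zero {N : ℕ} (hN : N ≠ 0) (m : ℕ) (n : ZMod (4 * N)) :
    fAct N (monomialVec N 0 m n) = monomialVec N 0 (m + 1) n := by
  rw [fAct_monomialVec hN, brace_zero, zero_div, zero_smul, sub_zero]

theorem kAct_mul_kinvAct (N : ℕ) : kAct N * kinvAct N = 1 := by
  refine monomialSpace_hom_ext fun i m n => ?_
  rw [Module.End.mul_apply, kinvAct_monomialVec, map_smul, kAct_monomialVec, smul_smul,
    ← qPow_add, sub_add_cancel, sub_add_sub_cancel, sub_self, qPow_zero, one_smul]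
  rfl

theorem kinvAct_mul_kAct (N : ℕ) : kinvAct N * kAct N = 1 := by
  refine monomialSpace_hom_ext fun i m n => ?_
  rw [Module.End.mul_apply, kAct_monomialVec, map_smul, kinvAct_monomialVec, smul_smul,
    ← qPow_add, add_sub_cancel_right, sub_add_sub_cancel, sub_self, qPow_zero, one_smul]
  rfl

theorem kAct_mul_eAct (N : ℕ) : kAct N * eAct N = qPow N 1 • (eAct N * kAct N) := by
  refine monomialSpace_hom_ext fun i m n => ?_
  simp only [Module.End.mul_apply, LinearMap.smul_apply, eAct_monomialVec, kAct_monomialVec,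
    map_smul, smul_smul, ← qPow_add]
  congr 2
  push_cast
  ring

theorem kAct_mul_fAct {N : ℕ} (hN : N ≠ 0) :
    kAct N * fAct N = qPow N (-1) • (fAct N * kAct N) := by
  refine monomialSpace_hom_ext fun i m n => ?_
  simp only [Module.End.mul_apply, LinearMap.smul_apply, fAct_monomialVec hN, kAct_monomialVec,
    map_smul, smul_smul, ← qPow_add, map_sub, smul_sub]
  cases i with
  | zero =>
    simp only [brace_zero, zero_div, zero_mul, mul_zero, zero_smul, sub_zero]
    congr 2
    push_cast
    ring
  | succ i =>
    simp only [Nat.add_sub_cancel]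
    have e1 : n + 1 + 2 = n + 2 + 1 := by ring
    have e2 : n + 1 - 2 = n - 2 + 1 := by ring
    rw [e1, e2]
    generalize brace N (i + 1) / brace N 1 ^ 2 = c
    congr 1
    · congr 2
      push_cast
      ring
    · congr 1 <;>
      · rw [mul_left_comm (qPow N (((i + 1 : ℕ) : ℂ) - m)) c, mul_left_comm (qPow N (-1)) c,
          mul_assoc c]
        simp only [← qPow_add]
        congr 3
        push_cast
        ring

theorem eAct_mul_fAct {N : ℕ} (hN : 2 ≤ N) :
    eAct N * fAct N - fAct N * eAct N =
      (qPow N 1 - qPow N (-1))⁻¹ • (kAct N ^ 2 - kinvAct N ^ 2) := by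
  have hN0 : N ≠ 0 := by omega
  have hb : brace N 1 = qPow N 1 - qPow N (-1) := by simp [brace]
  have hb0 : brace N 1 ≠ 0 := brace_ne_zero one_pos hN
  rw [← hb]
  refine monomialSpace_hom_ext fun i m n => ?_
  have e1 : n + 1 + 1 = n + 2 := by ring
  have e2 : n - 1 - 1 = n - 2 := by ring
  have c1 : brace N (i + 1) / brace N 1 ^ 2 * qPow N (((i + 1 : ℕ) : ℂ) - 1 - 2 * m) -
      brace N i / brace N 1 ^ 2 * qPow N ((i : ℂ) - 1 - 2 * m) =
      (brace N 1)⁻¹ * (qPow N (i - m) * qPow N (i - m)) := by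
    rw [inv_eq_one_div, ← qPow_add]
    field_simp
    simp only [brace, sub_mul, ← qPow_add]
    push_cast
    ring_nf
  have c2 : brace N (i + 1) / brace N 1 ^ 2 * qPow N (-(((i + 1 : ℕ) : ℂ) - 1 - 2 * m)) -
      brace N i / brace N 1 ^ 2 * qPow N (-((i : ℂ) - 1 - 2 * m)) =
      (brace N 1)⁻¹ * (qPow N (m - i) * qPow N (m - i)) := by
    rw [inv_eq_one_div, ← qPow_add]
    field_simp
    simp only [brace, sub_mul, ← qPow_add]
    push_cast
    ring_nf
  have key : ∀ n', (brace N i / brace N 1 ^ 2) • monomialVec N (i - 1 + 1) m n' =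
      (brace N i / brace N 1 ^ 2) • monomialVec N i m n' := fun n' => by
    cases i with
    | zero => simp [brace_zero]
    | succ i => rfl
  rw [pow_two (kAct N), pow_two (kinvAct N)]
  simp only [Module.End.mul_apply, LinearMap.smul_apply, LinearMap.sub_apply,
    eAct_monomialVec, fAct_monomialVec hN0, kAct_monomialVec, kinvAct_monomialVec, map_smul,
    map_sub, smul_sub, smul_smul, e1, e2, Nat.add_sub_cancel, ← c1, ← c2]
  rw [mul_comm (brace N i / _) (qPow N _), mul_comm (brace N i / _) (qPow N _),
    mul_smul _ _ (monomialVec N (i - 1 + 1) m (n + 2)), key,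
    mul_smul _ _ (monomialVec N (i - 1 + 1) m (n - 2)), key]
  module

theorem eAct_pow_monomialVec (N r i m : ℕ) (n : ZMod (4 * N)) :
    (eAct N ^ r) (monomialVec N i m n) = monomialVec N (i + r) m n := by
  induction r with
  | zero => rfl
  | succ r ih => rw [pow_succ', Module.End.mul_apply, ih, eAct_monomialVec, add_assoc]

theorem fAct_pow_monomialVec_zero {N : ℕ} (hN : N ≠ 0) (r m : ℕ) (n : ZMod (4 * N)) :
    (fAct N ^ r) (monomialVec N 0 m n) = monomialVec N 0 (m + r) n := by
  induction r with
  | zero => rfl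
  | succ r ih => rw [pow_succ', Module.End.mul_apply, ih, fAct_monomialVec_zero hN, add_assoc]

theorem eAct_pow_self (N : ℕ) : eAct N ^ N = 0 := by
  refine monomialSpace_hom_ext fun i m n => ?_
  rw [eAct_pow_monomialVec, monomialVec_of_le_left _ _ (by omega), LinearMap.zero_apply]

theorem kAct_pow_monomialVec (N r i m : ℕ) (n : ZMod (4 * N)) :
    (kAct N ^ r) (monomialVec N i m n) = qPow N (r * (i - m)) • monomialVec N i m (n + r) := by
  induction r with
  | zero => simp [qPow_zero]
  | succ r ih =>
    rw [pow_succ', Module.End.mul_apply, ih, map_smul, kAct_monomialVec, smul_smul, ← qPow_add,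
      add_assoc]
    congr 2
    · push_cast
      ring
    · push_cast
      ring

theorem kAct_pow_self {N : ℕ} (hN : N ≠ 0) : kAct N ^ (4 * N) = 1 := by
  refine monomialSpace_hom_ext fun i m n => ?_
  rw [kAct_pow_monomialVec, qPow_congr hN (y := 0) (2 * (i - m)) (by push_cast; ring), qPow_zero,
    ZMod.natCast_self, add_zero, one_smul]
  rfl

theorem conj_eq_of_mul_eq {A : Type*} [Ring A] [Algebra ℂ A] {g h a : A} {c : ℂ}
    (hg : g * h = 1) (hc : g * a = c • (a * g)) : g * a * h = c • a := by
  rw [hc, smul_mul_assoc, mul_assoc, hg, mul_one]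

theorem mul_eq_of_conj_eq {A : Type*} [Ring A] [Algebra ℂ A] {g h a : A} {c : ℂ}
    (hh : h * g = 1) (hc : g * a * h = c • a) : g * a = c • (a * g) := by
  rw [← smul_mul_assoc, ← hc, mul_assoc, hh, mul_one]

theorem sq_mul_eq {A : Type*} [Ring A] [Algebra ℂ A] {g a : A} {c : ℂ}
    (hc : g * a = c • (a * g)) : g ^ 2 * a = (c * c) • (a * g ^ 2) := by
  rw [pow_two, mul_assoc, hc, mul_smul_comm, ← mul_assoc, hc, smul_mul_assoc, smul_smul,
    mul_assoc]

theorem inv_mul_eq {A : Type*} [Ring A] [Algebra ℂ A] {g h a : A} {N : ℕ} {x : ℂ}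
    (hg : g * h = 1) (hh : h * g = 1) (hc : g * a = qPow N x • (a * g)) :
    h * a = qPow N (-x) • (a * h) := by
  have : h * (g * a) * h = qPow N x • (h * a) := by
    rw [hc, mul_smul_comm, smul_mul_assoc, mul_assoc, mul_assoc, hg, mul_one]
  rw [← mul_assoc, hh, one_mul] at this
  rw [this, smul_smul, ← qPow_add, neg_add_cancel, qPow_zero, one_smul]

theorem fAct_pow_self {N : ℕ} (hN : 2 ≤ N) : fAct N ^ N = 0 := by
  have hN0 : N ≠ 0 := by omega
  have hk := kAct_mul_fAct hN0
  have hl := inv_mul_eq (A := Module.End ℂ (MonomialSpace N)) (kAct_mul_kinvAct N)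
    (kinvAct_mul_kAct N) hk
  have hk2 := sq_mul_eq (A := Module.End ℂ (MonomialSpace N)) hk
  have hl2 := sq_mul_eq (A := Module.End ℂ (MonomialSpace N)) hl
  rw [← qPow_add] at hk2 hl2
  norm_num at hk2 hl2
  -- `f^N` commutes with `e`, since `[N] = 0`, and it kills the vectors of the monomials `fᵐ kⁿ`
  have hcomm : eAct N * fAct N ^ N = fAct N ^ N * eAct N := by
    have h := mul_pow_succ_eq_pow_succ_mul_add hN hk2 hl2 (eAct_mul_fAct hN) (N - 1)
    rwa [Nat.sub_add_cancel (by omega), brace_self hN0, zero_div, zero_smul, add_zero] at h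
  refine monomialSpace_hom_ext fun i m n => ?_
  have h0 : monomialVec N i m n = (eAct N ^ i) (monomialVec N 0 m n) := by
    rw [eAct_pow_monomialVec, zero_add]
  rw [h0, ← Module.End.mul_apply, ← (Commute.pow_left (show Commute _ _ from hcomm) i).eq,
    Module.End.mul_apply, fAct_pow_monomialVec_zero hN0, monomialVec_of_le_right _ _ (by omega),
    map_zero, LinearMap.zero_apply]

/-! ### The relations between the generators -/

theorem ExtQG.mkAlgHom_rel {N : ℕ} {a b : Free} (h : ExtRel N a b) :
    RingQuot.mkAlgHom ℂ (ExtRel N) a = RingQuot.mkAlgHom ℂ (ExtRel N) b :=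
  RingQuot.mkAlgHom_rel ℂ h

theorem SmallQG.mkAlgHom_rel {N : ℕ} {a b : Free} (h : SmallRel N a b) :
    RingQuot.mkAlgHom ℂ (SmallRel N) a = RingQuot.mkAlgHom ℂ (SmallRel N) b :=
  RingQuot.mkAlgHom_rel ℂ h

/-- The Cartan generator of `ExtQG N` as a unit. -/
noncomputable def kUnit (N : ℕ) : (ExtQG N)ˣ where
  val := ExtQG.gen N .K
  inv := ExtQG.gen N .Kinv
  val_inv := by simpa [ExtQG.gen] using ExtQG.mkAlgHom_rel (ExtRel.k_mul_kinv (N := N))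
  inv_val := by simpa [ExtQG.gen] using ExtQG.mkAlgHom_rel (ExtRel.kinv_mul_k (N := N))

theorem kUnit_pow_self (N : ℕ) : kUnit N ^ (4 * N) = 1 := by
  ext
  simpa [ExtQG.gen, kUnit] using ExtQG.mkAlgHom_rel (ExtRel.k_pow (N := N))

theorem kUnit_zpow_natCast (N n : ℕ) :
    ((kUnit N ^ (n : ℤ) : (ExtQG N)ˣ) : ExtQG N) = ExtQG.gen N .K ^ n := by
  rw [zpow_natCast, Units.val_pow_eq_pow_val]
  rfl

theorem kUnit_zpow_periodic (N : ℕ) :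
    Function.Periodic (fun n : ℤ => kUnit N ^ n) ((4 * N : ℕ) : ℤ) := fun n => by
  simp only [zpow_add, zpow_natCast, kUnit_pow_self, mul_one]

theorem ExtQG.e_pow (N : ℕ) : ExtQG.gen N .E ^ N = 0 := by
  simpa [ExtQG.gen] using ExtQG.mkAlgHom_rel (ExtRel.e_pow (N := N))

theorem kUnit_mul_e (N : ℕ) :
    (kUnit N : ExtQG N) * ExtQG.gen N .E = qPow N 1 • (ExtQG.gen N .E * kUnit N) :=
  mul_eq_of_conj_eq (kUnit N).inv_val
    (by simpa [ExtQG.gen, kUnit] using ExtQG.mkAlgHom_rel (ExtRel.k_conj_e (N := N)))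

theorem kUnit_mul_f (N : ℕ) :
    (kUnit N : ExtQG N) * ExtQG.gen N .F = qPow N (-1) • (ExtQG.gen N .F * kUnit N) :=
  mul_eq_of_conj_eq (kUnit N).inv_val
    (by simpa [ExtQG.gen, kUnit] using ExtQG.mkAlgHom_rel (ExtRel.k_conj_f (N := N)))

/-! ### The right integral -/

/-- The operators by which the generators act on the space of monomials. -/
noncomputable def genAct (N : ℕ) : Gen → Module.End ℂ (MonomialSpace N)
  | .K => kAct N
  | .Kinv => kinvAct N
  | .E => eAct N
  | .F => fAct N

theorem genAct_rel {N : ℕ} (hN : 2 ≤ N) ⦃x y : Free⦄ (h : ExtRel N x y) :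
    FreeAlgebra.lift ℂ (genAct N) x = FreeAlgebra.lift ℂ (genAct N) y := by
  have hN0 : N ≠ 0 := by omega
  cases h with
  | k_mul_kinv => simpa [genAct] using kAct_mul_kinvAct N
  | kinv_mul_k => simpa [genAct] using kinvAct_mul_kAct N
  | k_conj_e =>
    simpa [genAct] using conj_eq_of_mul_eq (A := Module.End ℂ (MonomialSpace N))
      (kAct_mul_kinvAct N) (kAct_mul_eAct N)
  | k_conj_f =>
    simpa [genAct] using conj_eq_of_mul_eq (A := Module.End ℂ (MonomialSpace N))
      (kAct_mul_kinvAct N) (kAct_mul_fAct hN0)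
  | e_comm_f => simpa [genAct] using eAct_mul_fAct hN
  | e_pow => simpa [genAct] using eAct_pow_self N
  | f_pow => simpa [genAct] using fAct_pow_self hN
  | k_pow => simpa [genAct] using kAct_pow_self hN0

/-- The representation of `ExtQG N` on the space of monomials by left multiplication. -/
noncomputable def monomialRep {N : ℕ} (hN : 2 ≤ N) :
    ExtQG N →ₐ[ℂ] Module.End ℂ (MonomialSpace N) :=
  RingQuot.liftAlgHom ℂ ⟨FreeAlgebra.lift ℂ (genAct N), genAct_rel hN⟩

theorem monomialRep_gen {N : ℕ} (hN : 2 ≤ N) (g : Gen) :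
    monomialRep hN (ExtQG.gen N g) = genAct N g := by
  rw [monomialRep, ExtQG.gen, RingQuot.liftAlgHom_mkAlgHom_apply, FreeAlgebra.lift_ι_apply]

theorem monomialRep_e_pow {N : ℕ} (hN : 2 ≤ N) (r i m : ℕ) (n : ZMod (4 * N)) :
    monomialRep hN (ExtQG.gen N .E ^ r) (monomialVec N i m n) = monomialVec N (i + r) m n := by
  rw [map_pow, monomialRep_gen, genAct, eAct_pow_monomialVec]

theorem monomialRep_kUnit_zpow {N : ℕ} (hN : 2 ≤ N) (a : ℤ) (i m : ℕ) (n : ZMod (4 * N)) :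
    monomialRep hN ((kUnit N ^ a : (ExtQG N)ˣ) : ExtQG N) (monomialVec N i m n) =
      qPow N (a * (i - m)) • monomialVec N i m (n + a) := by
  obtain ⟨r, rfl | rfl⟩ := a.eq_nat_or_neg
  · rw [kUnit_zpow_natCast, map_pow, monomialRep_gen, genAct, kAct_pow_monomialVec]
    simp
  · have h : monomialVec N i m n = monomialRep hN ((kUnit N ^ (r : ℤ) : (ExtQG N)ˣ) : ExtQG N)
        (qPow N (-r * (i - m)) • monomialVec N i m (n - r)) := by
      rw [kUnit_zpow_natCast, map_pow, monomialRep_gen, genAct, map_smul, kAct_pow_monomialVec,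
        smul_smul, ← qPow_add, neg_mul, neg_add_cancel, qPow_zero, one_smul, sub_add_cancel]
    rw [h, ← Module.End.mul_apply, ← map_mul, ← Units.val_mul, ← zpow_add, neg_add_cancel,
      zpow_zero, Units.val_one, map_one, Module.End.one_apply]
    push_cast
    rw [sub_eq_add_neg n]

theorem monomialRep_f_pow_zero {N : ℕ} (hN : 2 ≤ N) (r m : ℕ) (n : ZMod (4 * N)) :
    monomialRep hN (ExtQG.gen N .F ^ r) (monomialVec N 0 m n) = monomialVec N 0 (m + r) n := by
  rw [map_pow, monomialRep_gen, genAct, fAct_pow_monomialVec_zero (by omega)]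

/-- The span of the monomials `e^j fᵐ kⁿ` with `j < i`. -/
noncomputable def lowSpan (N i : ℕ) : Submodule ℂ (MonomialSpace N) :=
  Submodule.span ℂ {v | ∃ j m n, j < i ∧ v = monomialVec N j m n}

theorem monomialVec_mem_lowSpan {N i j : ℕ} (h : j < i) (m : ℕ) (n : ZMod (4 * N)) :
    monomialVec N j m n ∈ lowSpan N i := Submodule.subset_span ⟨j, m, n, h, rfl⟩

theorem fAct_sub_mem_lowSpan {N : ℕ} (hN : N ≠ 0) (i m : ℕ) (n : ZMod (4 * N)) :
    fAct N (monomialVec N i m n) - monomialVec N i (m + 1) n ∈ lowSpan N i := by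
  rw [fAct_monomialVec hN, sub_sub_cancel_left]
  cases i with
  | zero => simp [brace_zero]
  | succ i =>
    exact neg_mem (Submodule.smul_mem _ _ (sub_mem
      (Submodule.smul_mem _ _ (monomialVec_mem_lowSpan i.lt_succ_self _ _))
      (Submodule.smul_mem _ _ (monomialVec_mem_lowSpan i.lt_succ_self _ _))))

theorem fAct_mem_lowSpan {N : ℕ} (hN : N ≠ 0) {i : ℕ} {v : MonomialSpace N}
    (hv : v ∈ lowSpan N i) : fAct N v ∈ lowSpan N i := by
  have : lowSpan N i ≤ (lowSpan N i).comap (fAct N) := by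
    refine Submodule.span_le.2 ?_
    rintro _ ⟨j, m, n, hj, rfl⟩
    have h := fAct_sub_mem_lowSpan hN j m n
    have hle : lowSpan N j ≤ lowSpan N i := Submodule.span_mono
      fun v ⟨l, m, n, hl, e⟩ => ⟨l, m, n, hl.trans hj, e⟩
    have := add_mem (hle h) (monomialVec_mem_lowSpan hj (m + 1) n)
    rwa [sub_add_cancel] at this
  exact this hv

theorem monomialRep_kUnit_zpow_mem_lowSpan {N : ℕ} (hN : 2 ≤ N) (a : ℤ) {i : ℕ}
    {v : MonomialSpace N} (hv : v ∈ lowSpan N i) :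
    monomialRep hN ((kUnit N ^ a : (ExtQG N)ˣ) : ExtQG N) v ∈ lowSpan N i := by
  have : lowSpan N i ≤ (lowSpan N i).comap
      (monomialRep hN ((kUnit N ^ a : (ExtQG N)ˣ) : ExtQG N)) := by
    refine Submodule.span_le.2 ?_
    rintro _ ⟨j, m, n, hj, rfl⟩
    change _ ∈ lowSpan N i
    rw [monomialRep_kUnit_zpow]
    exact Submodule.smul_mem _ _ (monomialVec_mem_lowSpan hj _ _)
  exact this hv

theorem monomialRep_f_pow_sub_mem_lowSpan {N : ℕ} (hN : 2 ≤ N) (r i m : ℕ) (n : ZMod (4 * N)) :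
    monomialRep hN (ExtQG.gen N .F ^ r) (monomialVec N i m n) - monomialVec N i (m + r) n ∈
      lowSpan N i := by
  rw [map_pow, monomialRep_gen, genAct]
  induction r with
  | zero => simp
  | succ r ih =>
    rw [pow_succ', Module.End.mul_apply, ← add_assoc]
    have h := add_mem (fAct_mem_lowSpan (by omega) ih)
      (fAct_sub_mem_lowSpan (N := N) (by omega) i (m + r) n)
    rwa [map_sub, sub_add_sub_cancel] at h

/-- The coefficient of the monomial `e^(N-1) f^(N-1) k^(2N+2)`. -/
noncomputable def topCoeff (N : ℕ) : MonomialSpace N →ₗ[ℂ] ℂ :=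
  Finsupp.linearCombination ℂ fun p =>
    if (p.1 : ℕ) = N - 1 ∧ (p.2.1 : ℕ) = N - 1 ∧ p.2.2 = ((2 * N + 2 : ℤ) : ZMod (4 * N)) then 1
    else 0

theorem topCoeff_monomialVec {N : ℕ} (hN : N ≠ 0) (i m : ℕ) (n : ZMod (4 * N)) :
    topCoeff N (monomialVec N i m n) =
      if i = N - 1 ∧ m = N - 1 ∧ n = ((2 * N + 2 : ℤ) : ZMod (4 * N)) then 1 else 0 := by
  rw [monomialVec]
  split_ifs with h1 h2 h2
  · rw [topCoeff, Finsupp.linearCombination_single, if_pos h2, smul_eq_mul, mul_one]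
  · rw [topCoeff, Finsupp.linearCombination_single, if_neg h2, smul_zero]
  · omega
  · exact map_zero _

theorem topCoeff_of_mem_lowSpan {N i : ℕ} (hi : i < N) {v : MonomialSpace N}
    (hv : v ∈ lowSpan N i) : topCoeff N v = 0 := by
  have : lowSpan N i ≤ LinearMap.ker (topCoeff N) := by
    refine Submodule.span_le.2 ?_
    rintro _ ⟨j, m, n, hj, rfl⟩
    change topCoeff N _ = 0
    rw [topCoeff_monomialVec (by omega), if_neg (by omega)]
  exact this hv

/-- The extension of the right integral to `ExtQG N`: it takes the value `ζ` at the monomial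
`e^(N-1) f^(N-1) k^(2N+2)` and vanishes at the other basis monomials. -/
noncomputable def extIntegral {N : ℕ} (hN : 2 ≤ N) : ExtQG N →ₗ[ℂ] ℂ :=
  zeta N • (topCoeff N ∘ₗ LinearMap.applyₗ (monomialVec N 0 0 0) ∘ₗ (monomialRep hN).toLinearMap)

theorem extIntegral_apply {N : ℕ} (hN : 2 ≤ N) (x : ExtQG N) :
    extIntegral hN x = zeta N * topCoeff N (monomialRep hN x (monomialVec N 0 0 0)) := rfl

theorem extIntegral_e_first {N : ℕ} (hN : 2 ≤ N) (a b c : ℤ) (i m : ℕ) :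
    extIntegral hN (((kUnit N ^ a : (ExtQG N)ˣ) : ExtQG N) * ExtQG.gen N .E ^ i *
        ((kUnit N ^ b : (ExtQG N)ˣ) : ExtQG N) * ExtQG.gen N .F ^ m *
        ((kUnit N ^ c : (ExtQG N)ˣ) : ExtQG N)) =
      if i = N - 1 ∧ m = N - 1 ∧ ((4 * N : ℕ) : ℤ) ∣ a + b + c - (2 * N + 2) then
        zeta N * qPow N (-(b * m)) else 0 := by
  rw [extIntegral_apply]
  simp only [map_mul, Module.End.mul_apply, monomialRep_kUnit_zpow, map_smul,
    monomialRep_f_pow_zero, monomialRep_e_pow, topCoeff_monomialVec (show N ≠ 0 by omega)]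
  have e : ((c : ZMod (4 * N)) + b + a = ((2 * N + 2 : ℤ) : ZMod (4 * N))) ↔
      ((4 * N : ℕ) : ℤ) ∣ a + b + c - (2 * N + 2) := by
    rw [← ZMod.intCast_zmod_eq_zero_iff_dvd]
    push_cast
    rw [sub_eq_zero]
    ring_nf
  simp only [zero_add, e]
  split_ifs with h
  · obtain ⟨rfl, rfl, -⟩ := h
    rw [smul_eq_mul, smul_eq_mul, smul_eq_mul, mul_one, ← mul_assoc (qPow N _), ← qPow_add,
      ← qPow_add]
    congr 2
    push_cast
    ring
  · simp

/-- The monomials `f^m e^m` and `e^m f^m` agree modulo terms with fewer factors `e`, at which the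
integral vanishes. -/
theorem extIntegral_f_first {N : ℕ} (hN : 2 ≤ N) (a b c : ℤ) {m : ℕ} (hm : m < N) :
    extIntegral hN (((kUnit N ^ a : (ExtQG N)ˣ) : ExtQG N) * ExtQG.gen N .F ^ m *
        ((kUnit N ^ b : (ExtQG N)ˣ) : ExtQG N) * ExtQG.gen N .E ^ m *
        ((kUnit N ^ c : (ExtQG N)ˣ) : ExtQG N)) =
      if m = N - 1 ∧ ((4 * N : ℕ) : ℤ) ∣ a + b + c - (2 * N + 2) then
        zeta N * qPow N (b * m) else 0 := by
  rw [extIntegral_apply]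
  simp only [map_mul, Module.End.mul_apply, monomialRep_kUnit_zpow, map_smul, monomialRep_e_pow]
  have hlow := monomialRep_kUnit_zpow_mem_lowSpan hN a
    (monomialRep_f_pow_sub_mem_lowSpan hN m m 0 (0 + c + b))
  rw [map_sub, monomialRep_kUnit_zpow] at hlow
  have h0 := topCoeff_of_mem_lowSpan hm hlow
  rw [map_sub, map_smul, topCoeff_monomialVec (by omega), sub_eq_zero] at h0
  have e : ((c : ZMod (4 * N)) + b + a = ((2 * N + 2 : ℤ) : ZMod (4 * N))) ↔
      ((4 * N : ℕ) : ℤ) ∣ a + b + c - (2 * N + 2) := by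
    rw [← ZMod.intCast_zmod_eq_zero_iff_dvd]
    push_cast
    rw [sub_eq_zero]
    ring_nf
  simp only [zero_add, and_self_left, e] at h0 ⊢
  rw [h0]
  split_ifs with h
  · obtain ⟨rfl, -⟩ := h
    rw [smul_eq_mul, smul_eq_mul, smul_eq_mul, mul_one, ← qPow_add, ← qPow_add]
    congr 2
    push_cast
    ring
  · simp

/-! ### Uniqueness of the right integral -/

theorem SmallQG.K_mul_Kinv (N : ℕ) : SmallQG.gen N .K * SmallQG.gen N .Kinv = 1 := by
  simpa [SmallQG.gen] using SmallQG.mkAlgHom_rel (SmallRel.K_mul_Kinv (N := N))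

theorem SmallQG.Kinv_mul_K (N : ℕ) : SmallQG.gen N .Kinv * SmallQG.gen N .K = 1 := by
  simpa [SmallQG.gen] using SmallQG.mkAlgHom_rel (SmallRel.Kinv_mul_K (N := N))

theorem SmallQG.K_pow (N : ℕ) : SmallQG.gen N .K ^ (2 * N) = 1 := by
  simpa [SmallQG.gen] using SmallQG.mkAlgHom_rel (SmallRel.K_pow (N := N))

theorem SmallQG.E_pow (N : ℕ) : SmallQG.gen N .E ^ N = 0 := by
  simpa [SmallQG.gen] using SmallQG.mkAlgHom_rel (SmallRel.E_pow (N := N))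

theorem SmallQG.F_pow (N : ℕ) : SmallQG.gen N .F ^ N = 0 := by
  simpa [SmallQG.gen] using SmallQG.mkAlgHom_rel (SmallRel.F_pow (N := N))

theorem SmallQG.K_mul_E (N : ℕ) : SmallQG.gen N .K * SmallQG.gen N .E =
    qPow N 2 • (SmallQG.gen N .E * SmallQG.gen N .K) :=
  mul_eq_of_conj_eq (SmallQG.Kinv_mul_K N)
    (by simpa [SmallQG.gen] using SmallQG.mkAlgHom_rel (SmallRel.K_conj_E (N := N)))

theorem SmallQG.K_mul_F (N : ℕ) : SmallQG.gen N .K * SmallQG.gen N .F =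
    qPow N (-2) • (SmallQG.gen N .F * SmallQG.gen N .K) :=
  mul_eq_of_conj_eq (SmallQG.Kinv_mul_K N)
    (by simpa [SmallQG.gen] using SmallQG.mkAlgHom_rel (SmallRel.K_conj_F (N := N)))

theorem SmallQG.F_mul_E (N : ℕ) : SmallQG.gen N .F * SmallQG.gen N .E =
    SmallQG.gen N .E * SmallQG.gen N .F -
      (qPow N 1 - qPow N (-1))⁻¹ • (SmallQG.gen N .K - SmallQG.gen N .Kinv) := by
  have h : SmallQG.gen N .E * SmallQG.gen N .F - SmallQG.gen N .F * SmallQG.gen N .E =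
      (qPow N 1 - qPow N (-1))⁻¹ • (SmallQG.gen N .K - SmallQG.gen N .Kinv) := by
    simpa [SmallQG.gen] using SmallQG.mkAlgHom_rel (SmallRel.E_comm_F (N := N))
  rw [← h, sub_sub_cancel]

theorem mul_pow_eq_smul {A : Type*} [Ring A] [Algebra ℂ A] {g a : A} {c : ℂ}
    (h : g * a = c • (a * g)) (i : ℕ) : g * a ^ i = c ^ i • (a ^ i * g) := by
  induction i with
  | zero => simp
  | succ i ih =>
    rw [pow_succ a, ← mul_assoc, ih, smul_mul_assoc, mul_assoc, h, mul_smul_comm, smul_smul,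
      mul_assoc, pow_succ c]

/-- The span of all monomials `Eⁱ Fᵐ Kⁿ`. -/
noncomputable def SmallQG.monomialSpan (N : ℕ) : Submodule ℂ (SmallQG N) :=
  Submodule.span ℂ {x | ∃ i m n : ℕ,
    x = SmallQG.gen N .E ^ i * SmallQG.gen N .F ^ m * SmallQG.gen N .K ^ n}

theorem SmallQG.monomial_mem_monomialSpan (N i m n : ℕ) :
    SmallQG.gen N .E ^ i * SmallQG.gen N .F ^ m * SmallQG.gen N .K ^ n ∈ monomialSpan N :=
  Submodule.subset_span ⟨i, m, n, rfl⟩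

theorem SmallQG.mul_mem_monomialSpan_of {N : ℕ} {g : SmallQG N}
    (h : ∀ i m n : ℕ, g * (SmallQG.gen N .E ^ i * SmallQG.gen N .F ^ m * SmallQG.gen N .K ^ n) ∈
      monomialSpan N) {x : SmallQG N} (hx : x ∈ monomialSpan N) : g * x ∈ monomialSpan N := by
  have : monomialSpan N ≤ (monomialSpan N).comap (LinearMap.mulLeft ℂ g) := by
    refine Submodule.span_le.2 ?_
    rintro _ ⟨i, m, n, rfl⟩
    exact h i m n
  exact this hx

theorem SmallQG.K_mul_mem {N : ℕ} {x : SmallQG N} (hx : x ∈ monomialSpan N) :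
    SmallQG.gen N .K * x ∈ monomialSpan N := by
  refine mul_mem_monomialSpan_of (fun i m n => ?_) hx
  rw [← mul_assoc, ← mul_assoc, mul_pow_eq_smul (K_mul_E N), smul_mul_assoc, smul_mul_assoc,
    mul_assoc (_ ^ i), mul_pow_eq_smul (K_mul_F N), mul_smul_comm, smul_mul_assoc,
    ← mul_assoc (_ ^ i), mul_assoc _ _ (_ ^ n), ← pow_succ']
  exact Submodule.smul_mem _ _ (Submodule.smul_mem _ _ (monomial_mem_monomialSpan _ _ _ _))

theorem SmallQG.Kinv_mul_mem {N : ℕ} (hN : N ≠ 0) {x : SmallQG N} (hx : x ∈ monomialSpan N) :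
    SmallQG.gen N .Kinv * x ∈ monomialSpan N := by
  have h : SmallQG.gen N .Kinv = SmallQG.gen N .K ^ (2 * N - 1) := by
    rw [← one_mul (SmallQG.gen N .Kinv), ← K_pow N, ← Nat.sub_add_cancel (show 1 ≤ 2 * N by omega),
      pow_succ, mul_assoc, K_mul_Kinv, mul_one, Nat.add_sub_cancel]
  rw [h]
  generalize 2 * N - 1 = r
  induction r with
  | zero => rwa [pow_zero, one_mul]
  | succ r ih =>
    rw [pow_succ', mul_assoc]
    exact K_mul_mem ih

theorem SmallQG.E_mul_mem {N : ℕ} {x : SmallQG N} (hx : x ∈ monomialSpan N) :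
    SmallQG.gen N .E * x ∈ monomialSpan N := by
  refine mul_mem_monomialSpan_of (fun i m n => ?_) hx
  rw [← mul_assoc, ← mul_assoc, ← pow_succ']
  exact monomial_mem_monomialSpan _ _ _ _

theorem SmallQG.F_mul_mem {N : ℕ} (hN : N ≠ 0) {x : SmallQG N} (hx : x ∈ monomialSpan N) :
    SmallQG.gen N .F * x ∈ monomialSpan N := by
  refine mul_mem_monomialSpan_of (fun i m n => ?_) hx
  induction i with
  | zero =>
    rw [pow_zero, one_mul, ← mul_assoc, ← pow_succ', ← one_mul (_ ^ (m + 1)),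
      ← pow_zero (SmallQG.gen N .E)]
    exact monomial_mem_monomialSpan _ _ _ _
  | succ i ih =>
    have hx := monomial_mem_monomialSpan N i m n
    rw [pow_succ', mul_assoc, mul_assoc, ← mul_assoc (SmallQG.gen N .F), F_mul_E, sub_mul,
      smul_mul_assoc, sub_mul, mul_assoc (SmallQG.gen N .E), ← mul_assoc (_ ^ i)]
    exact sub_mem (E_mul_mem ih)
      (Submodule.smul_mem _ _ (sub_mem (K_mul_mem hx) (Kinv_mul_mem hN hx)))

theorem SmallQG.monomialSpan_eq_top {N : ℕ} (hN : N ≠ 0) : monomialSpan N = ⊤ := by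
  have key : ∀ a : Free, ∀ x ∈ monomialSpan N,
      RingQuot.mkAlgHom ℂ (SmallRel N) a * x ∈ monomialSpan N := by
    intro a
    induction a using FreeAlgebra.induction with
    | grade0 c =>
      intro x hx
      rw [AlgHom.commutes, ← Algebra.smul_def]
      exact Submodule.smul_mem _ _ hx
    | grade1 g =>
      intro x hx
      cases g with
      | K => exact K_mul_mem hx
      | Kinv => exact Kinv_mul_mem hN hx
      | E => exact E_mul_mem hx
      | F => exact F_mul_mem hN hx
    | mul a b ha hb =>
      intro x hx
      rw [map_mul, mul_assoc]
      exact ha _ (hb _ hx)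
    | add a b ha hb =>
      intro x hx
      rw [map_add, add_mul]
      exact add_mem (ha _ hx) (hb _ hx)
  refine Submodule.eq_top_iff'.2 fun x => ?_
  obtain ⟨a, rfl⟩ := RingQuot.mkAlgHom_surjective ℂ (SmallRel N) x
  have h1 : (1 : SmallQG N) ∈ monomialSpan N := by
    have := monomial_mem_monomialSpan N 0 0 0
    simpa using this
  have := key a 1 h1
  rwa [mul_one] at this

theorem IsRightIntegral.unique {N : ℕ} (hN : N ≠ 0) {μ ν : SmallQG N →ₗ[ℂ] ℂ}
    (hμ : IsRightIntegral N μ) (hν : IsRightIntegral N ν) : μ = ν := by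
  refine LinearMap.ext_on (SmallQG.monomialSpan_eq_top hN) ?_
  rintro _ ⟨i, m, n, rfl⟩
  rcases lt_or_ge i N with hi | hi
  · rcases lt_or_ge m N with hm | hm
    · have hn : SmallQG.gen N .K ^ n = SmallQG.gen N .K ^ (n % (2 * N)) :=
        pow_eq_pow_mod n (SmallQG.K_pow N)
      have hlt : n % (2 * N) < 2 * N := Nat.mod_lt _ (by omega)
      rw [hn, hμ i hi m hm _ hlt, hν i hi m hm _ hlt]
    · rw [pow_eq_zero_of_le hm (SmallQG.F_pow N), mul_zero, zero_mul, map_zero, map_zero]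
  · rw [pow_eq_zero_of_le hi (SmallQG.E_pow N), zero_mul, zero_mul, map_zero, map_zero]

theorem incl_gen (N : ℕ) (g : Gen) : incl N (SmallQG.gen N g) = inclGen N g := by
  rw [incl, SmallQG.gen, RingQuot.liftAlgHom_mkAlgHom_apply, FreeAlgebra.lift_ι_apply]

theorem isRightIntegral_extIntegral_incl {N : ℕ} (hN : 2 ≤ N) :
    IsRightIntegral N (extIntegral hN ∘ₗ (incl N).toLinearMap) := by
  intro i hi m hm n hn
  have h := extIntegral_e_first hN 0 0 ((2 * n : ℕ) : ℤ) i m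
  rw [zpow_zero, Units.val_one, one_mul, mul_one, kUnit_zpow_natCast, Int.cast_zero, zero_mul,
    neg_zero, qPow_zero, mul_one] at h
  rw [LinearMap.comp_apply, AlgHom.toLinearMap_apply, map_mul (incl N), map_mul (incl N),
    map_pow (incl N), map_pow (incl N), map_pow (incl N), incl_gen, incl_gen, incl_gen]
  change extIntegral hN (ExtQG.gen N .E ^ i * ExtQG.gen N .F ^ m * (ExtQG.gen N .K ^ 2) ^ n) = _
  rw [← pow_mul, h]
  have e : ((4 * N : ℕ) : ℤ) ∣ 0 + 0 + ((2 * n : ℕ) : ℤ) - (2 * N + 2) ↔ n = N + 1 := by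
    constructor
    · rintro ⟨z, hz⟩
      have hz' : (n : ℤ) - (N + 1) = 2 * N * z := by
        push_cast at hz
        linarith
      rcases lt_trichotomy z 0 with h | h | h
      · nlinarith
      · subst h
        omega
      · nlinarith
    · rintro rfl
      exact ⟨0, by push_cast; ring⟩
  simp only [e]

theorem rightIntegral_eq {N : ℕ} (hN : 2 ≤ N) :
    rightIntegral N = extIntegral hN ∘ₗ (incl N).toLinearMap := by
  have h : ∃ μ, IsRightIntegral N μ := ⟨_, isRightIntegral_extIntegral_incl hN⟩
  rw [rightIntegral, dif_pos h]
  exact IsRightIntegral.unique (by omega) h.choose_spec (isRightIntegral_extIntegral_incl hN)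

/-- The function `φ` can be computed in the extension `ExtQG N`. -/
theorem phi_eq {N : ℕ} (hN : 2 ≤ N) (x : SmallQG N) :
    phi N x = extIntegral hN
      (((kUnit N ^ (2 * N + 2 : ℤ) : (ExtQG N)ˣ) : ExtQG N) * incl N x) := by
  have e : (2 * N + 2 : ℤ) = ((2 * (N + 1) : ℕ) : ℤ) := by push_cast; ring
  rw [phi, rightIntegral_eq hN, LinearMap.comp_apply, AlgHom.toLinearMap_apply, map_mul (incl N),
    map_pow (incl N), incl_gen, e, kUnit_zpow_natCast, pow_mul]
  rfl

theorem psiPhi_eq {N : ℕ} (hN : 2 ≤ N) {n : ℕ} (D : KnotDiagram n) (x : Fin (n + 1))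
    (h : universalExt N D x ∈ (incl N).range) :
    psiPhi N D x = extIntegral hN
      (((kUnit N ^ (2 * N + 2 : ℤ) : (ExtQG N)ˣ) : ExtQG N) * universalExt N D x) := by
  have h' : ∃ u : SmallQG N, incl N u = universalExt N D x := h
  rw [psiPhi, phi_eq hN, universal, dif_pos h', h'.choose_spec]

/-! ### The inverse of the universal R-matrix -/

section Cartan

variable {B : Type*} [Ring B] [Algebra ℂ B]

/-- For a unit `x` of order dividing `4 N`, the projection to the eigenspace of `x` with eigenvalue
`q^(l/2)`. -/
noncomputable def eigenProj (N : ℕ) (x : Bˣ) (l : ℤ) : B :=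
  (1 / (4 * N) : ℂ) • ∑ n ∈ Finset.range (4 * N),
    qPow N (-(n * l / 2)) • ((x ^ (n : ℤ) : Bˣ) : B)

/-- The Cartan part `(4 N)⁻¹ ∑ q^(-nj/2) xⁿ yʲ` of the universal `R`-matrix. -/
noncomputable def cartanPart (N : ℕ) (x y : Bˣ) : B :=
  (1 / (4 * N) : ℂ) • ∑ n ∈ Finset.range (4 * N), ∑ j ∈ Finset.range (4 * N),
    qPow N (-(n * j / 2)) • ((x ^ (n : ℤ) * y ^ (j : ℤ) : Bˣ) : B)

theorem zpow_mul_eigenProj {N : ℕ} (hN : N ≠ 0) {x : Bˣ} (hx : x ^ (4 * N) = 1) (a l : ℤ) :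
    ((x ^ a : Bˣ) : B) * eigenProj N x l = qPow N (a * l / 2) • eigenProj N x l := by
  have hp : Function.Periodic
      (fun n : ℤ => qPow N (-(n * l / 2)) • ((x ^ n : Bˣ) : B)) ((4 * N : ℕ) : ℤ) := fun n => by
    simp only [zpow_add, zpow_natCast, hx, mul_one]
    congr 1
    exact qPow_congr hN (-l) (by push_cast; ring)
  rw [eigenProj, mul_smul_comm, smul_comm (qPow N _)]
  congr 1
  have h := sum_range_periodic_add hp a
  simp only [Int.cast_natCast] at h
  conv_rhs => rw [← h]
  rw [Finset.mul_sum, Finset.smul_sum]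
  refine Finset.sum_congr rfl fun n _ => ?_
  rw [mul_smul_comm, smul_smul, ← qPow_add, ← Units.val_mul, ← zpow_add, add_comm a (n : ℤ)]
  congr 2
  push_cast
  ring

theorem sum_eigenProj {N : ℕ} (hN : N ≠ 0) (x : Bˣ) :
    ∑ l ∈ Finset.range (4 * N), eigenProj N x l = 1 := by
  have hN' : (4 * N : ℂ) ≠ 0 := by
    have : (N : ℂ) ≠ 0 := by exact_mod_cast hN
    simpa using this
  have h : ∀ n ∈ Finset.range (4 * N), ∑ l ∈ Finset.range (4 * N),
      qPow N (-(n * (l : ℤ) / 2)) • ((x ^ (n : ℤ) : Bˣ) : B) =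
      if n = 0 then (4 * N : ℂ) • (1 : B) else 0 := by
    intro n hn
    have h1 := sum_qPow_half hN (-n)
    have h2 : ((4 * N : ℕ) : ℤ) ∣ -(n : ℤ) ↔ n = 0 := by
      rw [dvd_neg, Int.natCast_dvd_natCast]
      exact ⟨fun h => Nat.eq_zero_of_dvd_of_lt h (Finset.mem_range.1 hn), fun h => h ▸ dvd_zero _⟩
    simp only [h2] at h1
    rw [← Finset.sum_smul]
    have h3 : ∀ l : ℕ, -((n : ℂ) * ((l : ℤ) : ℂ) / 2) = l * ((-n : ℤ) : ℂ) / 2 := fun l => by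
      push_cast
      ring
    simp only [h3, h1]
    split_ifs with h0
    · simp [h0]
    · rw [zero_smul]
  simp only [eigenProj]
  rw [← Finset.smul_sum, Finset.sum_comm, Finset.sum_congr rfl h, Finset.sum_ite_eq',
    if_pos (Finset.mem_range.2 (by omega)), smul_smul, one_div_mul_cancel hN', one_smul]

theorem cartanPart_eq_sum (N : ℕ) (x y : Bˣ) :
    cartanPart N x y = ∑ j ∈ Finset.range (4 * N), eigenProj N x j * ((y ^ (j : ℤ) : Bˣ) : B) := by
  rw [cartanPart, Finset.sum_comm, Finset.smul_sum]
  refine Finset.sum_congr rfl fun j _ => ?_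
  rw [eigenProj, smul_mul_assoc, Finset.sum_mul]
  simp

/-- On the eigenspace of `x` with eigenvalue `q^(l/2)` the Cartan part acts as `y^l`. -/
theorem cartanPart_mul_eigenProj {N : ℕ} (hN : N ≠ 0) {x y : Bˣ} (hx : x ^ (4 * N) = 1)
    (hy : y ^ (4 * N) = 1) (hxy : Commute x y) (l : ℤ) :
    cartanPart N x y * eigenProj N x l = ((y ^ l : Bˣ) : B) * eigenProj N x l := by
  have hN' : (4 * N : ℂ) ≠ 0 := by
    have : (N : ℂ) ≠ 0 := by exact_mod_cast hN
    simpa using this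
  have hp : Function.Periodic (fun j : ℤ => ((y ^ j : Bˣ) : B) * eigenProj N x l)
      ((4 * N : ℕ) : ℤ) := fun j => by
    simp only [zpow_add, zpow_natCast, hy, mul_one]
  rw [← sum_range_periodic_ite (by omega : 4 * N ≠ 0) hp l, cartanPart, Finset.sum_comm,
    smul_mul_assoc, Finset.sum_mul, Finset.smul_sum]
  refine Finset.sum_congr rfl fun j _ => ?_
  have h : ∀ n ∈ Finset.range (4 * N),
      (qPow N (-(n * j / 2)) • ((x ^ (n : ℤ) * y ^ (j : ℤ) : Bˣ) : B)) * eigenProj N x l =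
      qPow N (n * ((l - j : ℤ) : ℂ) / 2) • (((y ^ (j : ℤ) : Bˣ) : B) * eigenProj N x l) := by
    intro n _
    rw [((hxy.zpow_left n).zpow_right j).eq, Units.val_mul, smul_mul_assoc, mul_assoc,
      zpow_mul_eigenProj hN hx, mul_smul_comm, smul_smul, ← qPow_add]
    congr 2
    push_cast
    ring
  rw [Finset.sum_mul, Finset.sum_congr rfl h, ← Finset.sum_smul, sum_qPow_half hN, smul_smul]
  simp only [dvd_sub_comm (b := l)]
  split_ifs
  · rw [one_div_mul_cancel hN', one_smul]
  · rw [mul_zero, zero_smul]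

theorem cartanPart_mul_cartanPart_inv {N : ℕ} (hN : N ≠ 0) {x y : Bˣ} (hx : x ^ (4 * N) = 1)
    (hy : y ^ (4 * N) = 1) (hxy : Commute x y) : cartanPart N x y * cartanPart N x y⁻¹ = 1 := by
  rw [cartanPart_eq_sum N x y⁻¹, Finset.mul_sum, ← sum_eigenProj hN x]
  refine Finset.sum_congr rfl fun l _ => ?_
  have hc : Commute ((y ^ (l : ℤ) : Bˣ) : B) (eigenProj N x l) := by
    refine Commute.smul_right (Commute.sum_right _ _ _ fun n _ => Commute.smul_right ?_ _) _
    exact ((hxy.symm.zpow_left l).zpow_right n).units_val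
  rw [← mul_assoc, cartanPart_mul_eigenProj hN hx hy hxy, hc.eq, mul_assoc, inv_zpow,
    Units.mul_inv, mul_one]

end Cartan

/-- The coefficient `q^(m(m-1)/2) / [m]!` of the quantum exponential function. -/
noncomputable def qExpCoeff (N m : ℕ) : ℂ := qPow N ((m : ℂ) * (m - 1) / 2) / qFactorial N m

/-- The coefficient `(-1)^m q^(-m(m-1)/2) / [m]!` of the inverse of the quantum exponential
function. -/
noncomputable def qExpInvCoeff (N m : ℕ) : ℂ :=
  (-1) ^ m * qPow N (-((m : ℂ) * (m - 1) / 2)) / qFactorial N m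

theorem brace_mul_qExpCoeff {N m : ℕ} (hm : m + 1 < N) :
    brace N (m + 1) * qExpCoeff N (m + 1) = brace N 1 * qPow N m * qExpCoeff N m := by
  have h1 : brace N 1 ≠ 0 := brace_ne_zero one_pos (by omega)
  have h2 : brace N (m + 1) ≠ 0 := brace_ne_zero m.succ_pos hm
  have h3 : qFactorial N m ≠ 0 := qFactorial_ne_zero (by omega) (by omega)
  have e : qPow N (((m + 1 : ℕ) : ℂ) * ((m + 1 : ℕ) - 1) / 2) =
      qPow N m * qPow N ((m : ℂ) * (m - 1) / 2) := by
    rw [← qPow_add]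
    congr 1
    push_cast
    ring
  rw [qExpCoeff, qExpCoeff, qFactorial_succ, qInt, e]
  field_simp

theorem brace_mul_qExpInvCoeff {N m : ℕ} (hm : m + 1 < N) :
    brace N (m + 1) * qExpInvCoeff N (m + 1) =
      -(brace N 1 * qPow N (-m) * qExpInvCoeff N m) := by
  have h1 : brace N 1 ≠ 0 := brace_ne_zero one_pos (by omega)
  have h2 : brace N (m + 1) ≠ 0 := brace_ne_zero m.succ_pos hm
  have h3 : qFactorial N m ≠ 0 := qFactorial_ne_zero (by omega) (by omega)
  have e : qPow N (-(((m + 1 : ℕ) : ℂ) * ((m + 1 : ℕ) - 1) / 2)) =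
      qPow N (-m) * qPow N (-((m : ℂ) * (m - 1) / 2)) := by
    rw [← qPow_add]
    congr 1
    push_cast
    ring
  rw [qExpInvCoeff, qExpInvCoeff, qFactorial_succ, qInt, e, pow_succ]
  field_simp

/-- The two quantum exponential functions are inverse to each other up to the order `N`: after
multiplication by `{d}`, written as `q^(-j) {i} + q^i {j}`, the sum telescopes. -/
theorem sum_antidiagonal_qExpCoeff {N d : ℕ} (hd : d < N) :
    ∑ p ∈ Finset.HasAntidiagonal.antidiagonal d, qExpCoeff N p.1 * qExpInvCoeff N p.2 =
      if d = 0 then 1 else 0 := by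
  cases d with
  | zero => simp [qExpCoeff, qExpInvCoeff, qPow_zero, qFactorial]
  | succ d =>
    rw [if_neg d.succ_ne_zero]
    refine (mul_eq_zero.1 ?_).resolve_left (brace_ne_zero d.succ_pos hd)
    have hb : ∀ p ∈ Finset.HasAntidiagonal.antidiagonal (d + 1),
        brace N (d + 1) * (qExpCoeff N p.1 * qExpInvCoeff N p.2) =
        qPow N (-p.2) * qExpInvCoeff N p.2 * (brace N p.1 * qExpCoeff N p.1) +
          qPow N p.1 * qExpCoeff N p.1 * (brace N p.2 * qExpInvCoeff N p.2) := by
      intro p hp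
      have : brace N (d + 1) = qPow N (-p.2) * brace N p.1 + qPow N p.1 * brace N p.2 := by
        rw [← Finset.HasAntidiagonal.mem_antidiagonal.1 hp]
        simp only [brace, mul_sub, ← qPow_add]
        push_cast
        ring_nf
      rw [this]
      ring
    rw [Finset.mul_sum, Finset.sum_congr rfl hb, Finset.sum_add_distrib,
      Finset.Nat.sum_antidiagonal_succ, Finset.Nat.sum_antidiagonal_succ']
    simp only [brace_zero, zero_mul, mul_zero, zero_add]
    rw [← Finset.sum_add_distrib]
    refine Finset.sum_eq_zero fun p hp => ?_
    have hp' := Finset.HasAntidiagonal.mem_antidiagonal.1 hp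
    rw [brace_mul_qExpCoeff (by omega), brace_mul_qExpInvCoeff (by omega)]
    ring

/-- For nilpotent `X` the quantum exponentials of `c X` are inverse to each other. The product is
computed in the polynomial ring modulo the `N`-th power of the variable. -/
theorem qExp_mul_qExpInv {B : Type*} [Ring B] [Algebra ℂ B] {N : ℕ} {X : B} (hX : X ^ N = 0)
    (c : ℂ) :
    (∑ m ∈ Finset.range N, (c ^ m * qExpCoeff N m) • X ^ m) *
      (∑ m ∈ Finset.range N, (c ^ m * qExpInvCoeff N m) • X ^ m) = 1 := by
  set P : Polynomial ℂ := ∑ m ∈ Finset.range N, Polynomial.monomial m (c ^ m * qExpCoeff N m)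
  set Q : Polynomial ℂ := ∑ m ∈ Finset.range N, Polynomial.monomial m (c ^ m * qExpInvCoeff N m)
  have hP : ∀ d < N, P.coeff d = c ^ d * qExpCoeff N d := fun d hd => by
    simp [P, Polynomial.finsetSum_coeff, Polynomial.coeff_monomial, hd]
  have hQ : ∀ d < N, Q.coeff d = c ^ d * qExpInvCoeff N d := fun d hd => by
    simp [Q, Polynomial.finsetSum_coeff, Polynomial.coeff_monomial, hd]
  have hdvd : Polynomial.X ^ N ∣ P * Q - 1 := by
    refine Polynomial.X_pow_dvd_iff.2 fun d hd => ?_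
    have h : ∀ p ∈ Finset.HasAntidiagonal.antidiagonal d, P.coeff p.1 * Q.coeff p.2 =
        c ^ d * (qExpCoeff N p.1 * qExpInvCoeff N p.2) := by
      intro p hp
      have hp' := Finset.HasAntidiagonal.mem_antidiagonal.1 hp
      rw [hP _ (by omega), hQ _ (by omega), ← hp', pow_add]
      ring
    rw [Polynomial.coeff_sub, Polynomial.coeff_mul, Finset.sum_congr rfl h, ← Finset.mul_sum,
      sum_antidiagonal_qExpCoeff hd, Polynomial.coeff_one]
    split_ifs with h0
    · simp [h0]
    · simp
  obtain ⟨S, hS⟩ := hdvd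
  have h := congrArg (Polynomial.aeval X) hS
  simp only [map_sub, map_mul, map_one, map_pow, Polynomial.aeval_X, hX, zero_mul, sub_eq_zero] at h
  simpa only [P, Q, map_sum, Polynomial.aeval_monomial, ← Algebra.smul_def] using h

theorem qExpInv_mul_qExp {B : Type*} [Ring B] [Algebra ℂ B] {N : ℕ} {X : B} (hX : X ^ N = 0)
    (c : ℂ) :
    (∑ m ∈ Finset.range N, (c ^ m * qExpInvCoeff N m) • X ^ m) *
      (∑ m ∈ Finset.range N, (c ^ m * qExpCoeff N m) • X ^ m) = 1 := by
  rw [← qExp_mul_qExpInv hX c]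
  refine Commute.sum_left _ _ _ fun i _ => Commute.sum_right _ _ _ fun j _ => ?_
  exact ((Commute.refl X).pow_pow i j).smul_left _ |>.smul_right _

/-- The element `∑ C m n j eᵐ kⁿ ⊗ fᵐ kʲ` of `𝒜 ⊗ 𝒜`. -/
noncomputable def tensorSum (N : ℕ) (C : ℕ → ℤ → ℤ → ℂ) : ExtQG N ⊗[ℂ] ExtQG N :=
  ∑ m ∈ Finset.range N, ∑ n ∈ Finset.range (4 * N), ∑ j ∈ Finset.range (4 * N),
    C m n j • ((ExtQG.gen N .E ^ m * ((kUnit N ^ (n : ℤ) : (ExtQG N)ˣ) : ExtQG N)) ⊗ₜ[ℂ]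
      (ExtQG.gen N .F ^ m * ((kUnit N ^ (j : ℤ) : (ExtQG N)ˣ) : ExtQG N)))

/-- The coefficients of the universal `R`-matrix. -/
noncomputable def rCoeff (N m : ℕ) (n j : ℤ) : ℂ :=
  1 / (4 * N) * (brace N 1 ^ m / qFactorial N m *
    qPow N ((m : ℂ) * (m - 1) / 2 + m * (n - j) - n * j / 2))

/-- The coefficients of the inverse of the universal `R`-matrix. -/
noncomputable def rInvCoeff (N m : ℕ) (n j : ℤ) : ℂ :=
  1 / (4 * N) * ((-1) ^ m * brace N 1 ^ m / qFactorial N m *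
    qPow N (-((m : ℂ) * (m - 1) / 2) + n * j / 2))

theorem rMatrix_eq_tensorSum (N : ℕ) : rMatrix N = tensorSum N (rCoeff N) := by
  simp only [rMatrix, tensorSum, Finset.smul_sum, smul_smul, kUnit_zpow_natCast, rCoeff,
    Int.cast_natCast]

/-- The unit `k ⊗ 1`. -/
noncomputable def kLeft (N : ℕ) : (ExtQG N ⊗[ℂ] ExtQG N)ˣ :=
  Units.map (Algebra.TensorProduct.includeLeft (R := ℂ) (S := ℂ) (A := ExtQG N)
    (B := ExtQG N)).toMonoidHom (kUnit N)

/-- The unit `1 ⊗ k`. -/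
noncomputable def kRight (N : ℕ) : (ExtQG N ⊗[ℂ] ExtQG N)ˣ :=
  Units.map (Algebra.TensorProduct.includeRight (R := ℂ) (A := ExtQG N)
    (B := ExtQG N)).toMonoidHom (kUnit N)

theorem kLeft_zpow_mul_kRight_zpow (N : ℕ) (n j : ℤ) :
    ((kLeft N ^ n * kRight N ^ j : (ExtQG N ⊗[ℂ] ExtQG N)ˣ) : ExtQG N ⊗[ℂ] ExtQG N) =
      ((kUnit N ^ n : (ExtQG N)ˣ) : ExtQG N) ⊗ₜ[ℂ] ((kUnit N ^ j : (ExtQG N)ˣ) : ExtQG N) := by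
  rw [kLeft, kRight, ← map_zpow, ← map_zpow, Units.val_mul, Units.coe_map, Units.coe_map]
  change (_ ⊗ₜ[ℂ] (1 : ExtQG N)) * ((1 : ExtQG N) ⊗ₜ[ℂ] _) = _
  rw [Algebra.TensorProduct.tmul_mul_tmul, one_mul, mul_one]

theorem kLeft_pow_self (N : ℕ) : kLeft N ^ (4 * N) = 1 := by
  rw [kLeft, ← map_pow, kUnit_pow_self, map_one]

theorem kRight_pow_self (N : ℕ) : kRight N ^ (4 * N) = 1 := by
  rw [kRight, ← map_pow, kUnit_pow_self, map_one]

theorem commute_kLeft_kRight (N : ℕ) : Commute (kLeft N) (kRight N) := by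
  ext
  change ((_ ⊗ₜ[ℂ] (1 : ExtQG N)) * ((1 : ExtQG N) ⊗ₜ[ℂ] _) : ExtQG N ⊗[ℂ] ExtQG N) =
    ((1 : ExtQG N) ⊗ₜ[ℂ] _) * (_ ⊗ₜ[ℂ] (1 : ExtQG N))
  simp only [Algebra.TensorProduct.tmul_mul_tmul, one_mul, mul_one]

/-- The nilpotent element `e ⊗ f`. -/
noncomputable def eTensorF (N : ℕ) : ExtQG N ⊗[ℂ] ExtQG N :=
  ExtQG.gen N .E ⊗ₜ[ℂ] ExtQG.gen N .F

theorem eTensorF_pow (N m : ℕ) :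
    eTensorF N ^ m = (ExtQG.gen N .E ^ m) ⊗ₜ[ℂ] (ExtQG.gen N .F ^ m) :=
  Algebra.TensorProduct.tmul_pow _ _ _

theorem eTensorF_pow_self (N : ℕ) : eTensorF N ^ N = 0 := by
  rw [eTensorF_pow, ExtQG.e_pow, TensorProduct.zero_tmul]

theorem kUnit_zpow_mul_pow {N : ℕ} {a : ExtQG N} {x : ℂ}
    (h : (kUnit N : ExtQG N) * a = qPow N x • (a * kUnit N)) (n : ℤ) (m : ℕ) :
    ((kUnit N ^ n : (ExtQG N)ˣ) : ExtQG N) * a ^ m =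
      qPow N (n * m * x) • (a ^ m * ((kUnit N ^ n : (ExtQG N)ˣ) : ExtQG N)) := by
  have key : ∀ n : ℕ, ((kUnit N ^ (n : ℤ) : (ExtQG N)ˣ) : ExtQG N) * a ^ m =
      qPow N (n * m * x) • (a ^ m * ((kUnit N ^ (n : ℤ) : (ExtQG N)ˣ) : ExtQG N)) := by
    intro n
    have h1 := mul_pow_eq_smul h m
    rw [qPow_pow] at h1
    rw [zpow_natCast, Units.val_pow_eq_pow_val]
    induction n with
    | zero => simp [qPow_zero]
    | succ n ih =>
      rw [pow_succ (kUnit N : ExtQG N), mul_assoc, h1, mul_smul_comm, ← mul_assoc, ih,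
        smul_mul_assoc, smul_smul, ← qPow_add, mul_assoc (a ^ m)]
      congr 2
      push_cast
      ring
  obtain ⟨r, rfl | rfl⟩ := n.eq_nat_or_neg
  · rw [key]
    simp
  · rw [zpow_neg, inv_mul_eq (Units.mul_inv _) (Units.inv_mul _) (key r)]
    congr 2
    push_cast
    ring

theorem rMatrix_eq_mul (N : ℕ) : rMatrix N = cartanPart N (kLeft N) (kRight N) *
    ∑ m ∈ Finset.range N, (brace N 1 ^ m * qExpCoeff N m) • eTensorF N ^ m := by
  rw [rMatrix_eq_tensorSum, tensorSum, cartanPart, Finset.mul_sum]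
  refine Finset.sum_congr rfl fun m _ => ?_
  rw [smul_mul_assoc, Finset.sum_mul, Finset.smul_sum]
  refine Finset.sum_congr rfl fun n _ => ?_
  rw [Finset.sum_mul, Finset.smul_sum]
  refine Finset.sum_congr rfl fun j _ => ?_
  rw [kLeft_zpow_mul_kRight_zpow, eTensorF_pow, smul_mul_assoc, mul_smul_comm,
    Algebra.TensorProduct.tmul_mul_tmul, kUnit_zpow_mul_pow (kUnit_mul_e N),
    kUnit_zpow_mul_pow (kUnit_mul_f N), TensorProduct.smul_tmul_smul, smul_smul, smul_smul,
    smul_smul]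
  congr 1
  rw [rCoeff, qExpCoeff]
  have e : (m : ℂ) * (m - 1) / 2 + m * (((n : ℤ) : ℂ) - ((j : ℤ) : ℂ)) -
      ((n : ℤ) : ℂ) * ((j : ℤ) : ℂ) / 2 =
      -(n * j / 2) + (m : ℂ) * (m - 1) / 2 + ((n : ℤ) * m * 1 + (j : ℤ) * m * -1) := by
    push_cast
    ring
  rw [e, qPow_add, qPow_add, qPow_add]
  ring

theorem tensorSum_rInvCoeff_eq_mul {N : ℕ} (hN : N ≠ 0) : tensorSum N (rInvCoeff N) =
    (∑ m ∈ Finset.range N, (brace N 1 ^ m * qExpInvCoeff N m) • eTensorF N ^ m) *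
      cartanPart N (kLeft N) (kRight N)⁻¹ := by
  rw [tensorSum, cartanPart, Finset.sum_mul]
  refine Finset.sum_congr rfl fun m _ => ?_
  rw [mul_smul_comm, Finset.mul_sum, Finset.smul_sum]
  refine Finset.sum_congr rfl fun n _ => ?_
  have hp : Function.Periodic (fun j : ℤ => rInvCoeff N m n j •
      ((ExtQG.gen N .E ^ m * ((kUnit N ^ (n : ℤ) : (ExtQG N)ˣ) : ExtQG N)) ⊗ₜ[ℂ]
      (ExtQG.gen N .F ^ m * ((kUnit N ^ j : (ExtQG N)ˣ) : ExtQG N)))) ((4 * N : ℕ) : ℤ) := by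
    intro j
    have := kUnit_zpow_periodic N j
    simp only at this ⊢
    rw [this, rInvCoeff, qPow_congr hN (y := -((m : ℂ) * (m - 1) / 2) + n * j / 2) n
      (by push_cast; ring)]
    rfl
  rw [← sum_range_periodic_neg hp, Finset.mul_sum, Finset.smul_sum]
  refine Finset.sum_congr rfl fun j _ => ?_
  rw [inv_zpow', kLeft_zpow_mul_kRight_zpow, eTensorF_pow, smul_mul_assoc, mul_smul_comm,
    Algebra.TensorProduct.tmul_mul_tmul, smul_smul, smul_smul]
  congr 1
  rw [rInvCoeff, qExpInvCoeff]
  have e : -((m : ℂ) * (m - 1) / 2) + ((n : ℤ) : ℂ) * ((-j : ℤ) : ℂ) / 2 =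
      -((m : ℂ) * (m - 1) / 2) + -(n * j / 2) := by
    push_cast
    ring
  rw [e, qPow_add]
  ring

/-- The inverse of the universal `R`-matrix `R = D Θ` is `Θ⁻¹ D⁻¹`, where `D` is the Cartan part
and `Θ` the quantum exponential of `e ⊗ f`. -/
theorem rMatrixInv_eq_tensorSum {N : ℕ} (hN : N ≠ 0) :
    rMatrixInv N = tensorSum N (rInvCoeff N) := by
  have h1 := cartanPart_mul_cartanPart_inv (B := ExtQG N ⊗[ℂ] ExtQG N) hN (kLeft_pow_self N)
    (kRight_pow_self N) (commute_kLeft_kRight N)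
  have h2 := cartanPart_mul_cartanPart_inv (B := ExtQG N ⊗[ℂ] ExtQG N) hN (kLeft_pow_self N)
    (y := (kRight N)⁻¹) (by rw [inv_pow, kRight_pow_self, inv_one])
    (Commute.inv_right (commute_kLeft_kRight N))
  rw [inv_inv] at h2
  have h3 := qExp_mul_qExpInv (B := ExtQG N ⊗[ℂ] ExtQG N) (eTensorF_pow_self N) (brace N 1)
  have h4 := qExpInv_mul_qExp (B := ExtQG N ⊗[ℂ] ExtQG N) (eTensorF_pow_self N) (brace N 1)
  rw [tensorSum_rInvCoeff_eq_mul hN, rMatrixInv, rMatrix_eq_mul]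
  refine Ring.inverse_unit ⟨_, _, ?_, ?_⟩
  · rw [mul_assoc, ← mul_assoc (∑ m ∈ _, _), h3, one_mul, h1]
  · rw [mul_assoc, ← mul_assoc (cartanPart _ _ _), h2, one_mul, h4]

/-! ### The universal invariant of the one-crossing unknots -/

theorem braidInvariant_unknot (N : ℕ) (s : Bool) :
    braidInvariant N 1 (unknot s).word =
      if s then place N 1 0 1 (rMatrix N) else place N 1 1 0 (rMatrixInv N) := by
  have h : ∀ σ, permute N 1 σ 1 = 1 := fun σ => by
    rw [permute, PiTensorProduct.one_def, LinearEquiv.coe_coe]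
    exact PiTensorProduct.reindex_tprod σ _
  change permute N 1 _ 1 * _ = _
  rw [h, one_mul]
  cases s <;> rfl

theorem walkProduct_unknot_tprod (N : ℕ) (s : Bool) (x : Fin 2) (v : Fin 2 → ExtQG N) :
    walkProduct N (unknot s) x (PiTensorProduct.tprod ℂ v) =
      v (1 - x) * closingElement N * (v x * closingElement N) := by
  have h0 : braidPerm (unknot s).word x = 1 - x := by
    revert x s
    decide
  have h1 : (braidPerm (unknot s).word ^ 2) x = x := by
    revert x s
    decide
  rw [walkProduct, PiTensorProduct.lift.tprod]
  simp [MultilinearMap.mkPiAlgebraFin_apply, List.ofFn_succ, h0, h1]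

theorem place_tmul (N : ℕ) (i j : Fin 2) (a b : ExtQG N) :
    place N 1 i j (a ⊗ₜ[ℂ] b) =
      PiTensorProduct.tprod ℂ (Pi.mulSingle i a * Pi.mulSingle j b : Fin 2 → ExtQG N) := by
  rw [← PiTensorProduct.tprod_mul_tprod]
  rfl

theorem walkProduct_place_over_first (N : ℕ) (s : Bool) (x : Fin 2) (a b : ExtQG N) :
    walkProduct N (unknot s) x (place N 1 (1 - x) x (a ⊗ₜ[ℂ] b)) =
      a * closingElement N * (b * closingElement N) := by
  rw [place_tmul, walkProduct_unknot_tprod]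
  fin_cases x <;> simp

theorem walkProduct_place_under_first (N : ℕ) (s : Bool) (x : Fin 2) (a b : ExtQG N) :
    walkProduct N (unknot s) x (place N 1 x (1 - x) (a ⊗ₜ[ℂ] b)) =
      b * closingElement N * (a * closingElement N) := by
  rw [place_tmul, walkProduct_unknot_tprod]
  fin_cases x <;> simp

theorem closingElement_eq (N : ℕ) (hN : N ≠ 0) :
    closingElement N = ((kUnit N ^ (2 - 2 * N : ℤ) : (ExtQG N)ˣ) : ExtQG N) := by
  have : (2 - 2 * N : ℤ) = -((2 * (N - 1) : ℕ) : ℤ) := by omega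
  rw [this, zpow_neg, ← inv_zpow, zpow_natCast, Units.val_pow_eq_pow_val]
  rfl

theorem zpow_mul_closing_mul {N : ℕ} (hN : N ≠ 0) {a b : ExtQG N} {x : ℤ}
    (h : (kUnit N : ExtQG N) * b = qPow N x • (b * kUnit N)) (n j : ℤ) (m : ℕ) :
    a * ((kUnit N ^ n : (ExtQG N)ˣ) : ExtQG N) * closingElement N *
        (b ^ m * ((kUnit N ^ j : (ExtQG N)ˣ) : ExtQG N) * closingElement N) =
      qPow N ((n + 2) * m * x) •
        (a * b ^ m * ((kUnit N ^ (n + j + 4) : (ExtQG N)ˣ) : ExtQG N)) := by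
  have hp : kUnit N ^ (n + (2 - 2 * N) + (j + (2 - 2 * N)) : ℤ) = kUnit N ^ (n + j + 4) := by
    have := kUnit_zpow_periodic N (n + (2 - 2 * N) + (j + (2 - 2 * N)))
    simp only at this
    rw [← this]
    congr 1
    push_cast
    ring
  rw [closingElement_eq N hN, mul_assoc a, mul_assoc (b ^ m), ← Units.val_mul, ← zpow_add,
    ← Units.val_mul, ← zpow_add, mul_assoc a, ← mul_assoc _ (b ^ m), kUnit_zpow_mul_pow h,
    smul_mul_assoc, mul_assoc (b ^ m), ← Units.val_mul, ← zpow_add, hp, mul_smul_comm, mul_assoc a]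
  congr 1
  exact qPow_congr hN (-(m * x)) (by push_cast; ring)

/-- On a walk that meets the over strand first, the Cartan factors can be collected on the
right. -/
theorem walkProduct_tensorSum_over_first {N : ℕ} (hN : N ≠ 0) (s : Bool) (x : Fin 2)
    (C : ℕ → ℤ → ℤ → ℂ) :
    walkProduct N (unknot s) x (place N 1 (1 - x) x (tensorSum N C)) =
      ∑ m ∈ Finset.range N, ∑ n ∈ Finset.range (4 * N), ∑ j ∈ Finset.range (4 * N),
        (C m n j * qPow N (-((n + 2) * m))) • (ExtQG.gen N .E ^ m * ExtQG.gen N .F ^ m *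
          ((kUnit N ^ (n + j + 4 : ℤ) : (ExtQG N)ˣ) : ExtQG N)) := by
  simp only [tensorSum, map_sum, map_smul, walkProduct_place_over_first]
  refine Finset.sum_congr rfl fun m _ => Finset.sum_congr rfl fun n _ =>
    Finset.sum_congr rfl fun j _ => ?_
  rw [zpow_mul_closing_mul hN (x := -1) (by simpa using kUnit_mul_f N), smul_smul]
  congr 3
  push_cast
  ring

theorem walkProduct_tensorSum_under_first {N : ℕ} (hN : N ≠ 0) (s : Bool) (x : Fin 2)
    (C : ℕ → ℤ → ℤ → ℂ) :
    walkProduct N (unknot s) x (place N 1 x (1 - x) (tensorSum N C)) =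
      ∑ m ∈ Finset.range N, ∑ n ∈ Finset.range (4 * N), ∑ j ∈ Finset.range (4 * N),
        (C m n j * qPow N ((j + 2) * m)) • (ExtQG.gen N .F ^ m * ExtQG.gen N .E ^ m *
          ((kUnit N ^ (n + j + 4 : ℤ) : (ExtQG N)ˣ) : ExtQG N)) := by
  simp only [tensorSum, map_sum, map_smul, walkProduct_place_under_first]
  refine Finset.sum_congr rfl fun m _ => Finset.sum_congr rfl fun n _ =>
    Finset.sum_congr rfl fun j _ => ?_
  rw [zpow_mul_closing_mul hN (x := 1) (by simpa using kUnit_mul_e N), smul_smul,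
    add_comm (j : ℤ) n]
  congr 3
  push_cast
  ring

theorem e_mem_range_incl (N : ℕ) : ExtQG.gen N .E ∈ (incl N).range := ⟨_, incl_gen N .E⟩

theorem f_mem_range_incl (N : ℕ) : ExtQG.gen N .F ∈ (incl N).range := ⟨_, incl_gen N .F⟩

theorem kUnit_zpow_mem_range_incl (N : ℕ) {a : ℤ} (ha : Even a) :
    ((kUnit N ^ a : (ExtQG N)ˣ) : ExtQG N) ∈ (incl N).range := by
  obtain ⟨b, rfl⟩ := even_iff_two_dvd.1 ha
  obtain ⟨r, rfl | rfl⟩ := b.eq_nat_or_neg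
  · have e : (2 * (r : ℤ)) = ((2 * r : ℕ) : ℤ) := by push_cast; rfl
    rw [e, kUnit_zpow_natCast, pow_mul]
    exact pow_mem (AlgHom.mem_range _ |>.2 ⟨_, incl_gen N .K⟩) _
  · have e : (2 * -(r : ℤ)) = -((2 * r : ℕ) : ℤ) := by push_cast; ring
    rw [e, zpow_neg, ← inv_zpow, zpow_natCast, Units.val_pow_eq_pow_val, pow_mul]
    exact pow_mem (AlgHom.mem_range _ |>.2 ⟨_, incl_gen N .Kinv⟩) _

/-- The coefficient function `(n, j) ↦ c q^(α + a n + b j + ε n j / 2)` on pairs of integers. -/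
noncomputable def quadCoeff (N : ℕ) (c α : ℂ) (a b ε n j : ℤ) : ℂ :=
  c * qPow N (α + a * n + b * j + ε * n * j / 2)

theorem quadCoeff_periodic_right {N : ℕ} (hN : N ≠ 0) (c α : ℂ) (a b ε n : ℤ) :
    Function.Periodic (quadCoeff N c α a b ε n) ((4 * N : ℕ) : ℤ) := fun j => by
  rw [quadCoeff, quadCoeff]
  congr 1
  exact qPow_congr hN (2 * b + ε * n) (by push_cast; ring)

theorem quadCoeff_periodic_left {N : ℕ} (hN : N ≠ 0) (c α : ℂ) (a b ε j : ℤ) :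
    Function.Periodic (fun n => quadCoeff N c α a b ε n j) ((4 * N : ℕ) : ℤ) := fun n => by
  simp only [quadCoeff]
  congr 1
  exact qPow_congr hN (2 * a + ε * j) (by push_cast; ring)

/-- The sign by which a coefficient changes under a shift of `(n, j)` by `(2 N, -2 N)`. -/
theorem quadCoeff_shift {N : ℕ} (hN : N ≠ 0) (c α : ℂ) (a b : ℤ) {ε : ℤ} (hε : Odd ε)
    (n j : ℤ) :
    quadCoeff N c α a b ε (n + 2 * N) (j + -(2 * N)) =
      (-1) ^ (n + j) * quadCoeff N c α a b ε n j := by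
  obtain ⟨δ, rfl⟩ := hε
  rw [quadCoeff, quadCoeff, ← qPow_natCast_self hN, qPow_zpow, mul_left_comm, ← qPow_add]
  congr 1
  exact qPow_congr hN (a - b - (2 * δ + 1) * N + δ * (j - n) - n) (by push_cast; ring)

/-- The terms in which `k` has an odd exponent cancel in pairs, so the sum lies in the small
quantum group. -/
theorem sum_quadCoeff_mem_range_incl {N : ℕ} (hN : N ≠ 0) {M : ExtQG N}
    (hM : M ∈ (incl N).range) (c α : ℂ) (a b : ℤ) {ε : ℤ} (hε : Odd ε) :
    ∑ n ∈ Finset.range (4 * N), ∑ j ∈ Finset.range (4 * N), quadCoeff N c α a b ε n j •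
      (M * ((kUnit N ^ (n + j + 4 : ℤ) : (ExtQG N)ˣ) : ExtQG N)) ∈ (incl N).range := by
  set T : ℤ → ℤ → ExtQG N := fun n j => quadCoeff N c α a b ε n j •
    (M * ((kUnit N ^ (n + j + 4 : ℤ) : (ExtQG N)ˣ) : ExtQG N)) with hT
  have hk : ∀ s : ℤ, kUnit N ^ (s + (4 * N : ℕ)) = kUnit N ^ s := kUnit_zpow_periodic N
  have hr : ∀ n, Function.Periodic (T n) ((4 * N : ℕ) : ℤ) := fun n j => by
    simp only [hT]
    rw [quadCoeff_periodic_right hN c α a b ε n j, ← hk (n + j + 4)]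
    congr 4
    ring
  have hl : ∀ j, Function.Periodic (fun n => T n j) ((4 * N : ℕ) : ℤ) := fun j n => by
    have := quadCoeff_periodic_left hN c α a b ε j n
    simp only at this
    simp only [hT]
    rw [this, ← hk (n + j + 4)]
    congr 4
    ring
  have hs : ∀ n j, T (n + 2 * N) (j + -(2 * N)) = (-1 : ℂ) ^ (n + j) • T n j := fun n j => by
    simp only [hT]
    rw [quadCoeff_shift hN c α a b hε, smul_smul]
    congr 5
    ring
  have hsum : ∑ n ∈ Finset.range (4 * N), ∑ j ∈ Finset.range (4 * N), T n j =
      ∑ n ∈ Finset.range (4 * N), ∑ j ∈ Finset.range (4 * N), (-1 : ℂ) ^ (n + j : ℤ) • T n j := by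
    have h1 : ∀ n : ℤ, ∑ j ∈ Finset.range (4 * N), T n j =
        ∑ j ∈ Finset.range (4 * N), T n (j + -(2 * N)) := fun n =>
      (sum_range_periodic_add (hr n) _).symm
    simp only [h1, ← hs]
    rw [Finset.sum_comm, Finset.sum_comm (γ := ℕ) (f := fun n j : ℕ => T (n + 2 * N) _)]
    refine Finset.sum_congr rfl fun j _ => ?_
    exact (sum_range_periodic_add (hl _) _).symm
  have hhalf : ∑ n ∈ Finset.range (4 * N), ∑ j ∈ Finset.range (4 * N), T n j =
      ∑ n ∈ Finset.range (4 * N), ∑ j ∈ Finset.range (4 * N),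
        ((1 + (-1 : ℂ) ^ (n + j : ℤ)) / 2) • T n j := by
    have h2 : ∀ n j : ℤ, ((1 + (-1 : ℂ) ^ (n + j)) / 2) • T n j =
        (1 / 2 : ℂ) • (T n j + (-1 : ℂ) ^ (n + j) • T n j) := fun n j => by module
    simp only [h2, ← Finset.smul_sum, Finset.sum_add_distrib, ← hsum]
    module
  rw [hhalf]
  refine sum_mem fun n _ => sum_mem fun j _ => ?_
  rcases Int.even_or_odd (n + j : ℤ) with h | h
  · exact Subalgebra.smul_mem _ (Subalgebra.smul_mem _
      (mul_mem hM (kUnit_zpow_mem_range_incl N (h.add (by decide)))) _) _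
  · rw [h.neg_one_zpow, add_neg_cancel, zero_div, zero_smul]
    exact zero_mem _

/-- The evaluation of `φ` on an element of the form that the universal invariants of the unknots
take: only the terms with `m = N - 1` and `n + j + 4 ≡ 0` modulo `4 N` contribute. -/
theorem psiPhi_eq_sum {N : ℕ} (hN : 2 ≤ N) {d : ℕ} (D : KnotDiagram d) (x : Fin (d + 1))
    {M : ℕ → ExtQG N} (hM : ∀ m, M m ∈ (incl N).range)
    (hint : ∀ m < N, ∀ s : ℤ, extIntegral hN
      (((kUnit N ^ (2 * N + 2 : ℤ) : (ExtQG N)ˣ) : ExtQG N) *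
        (M m * ((kUnit N ^ s : (ExtQG N)ˣ) : ExtQG N))) =
      if m = N - 1 ∧ ((4 * N : ℕ) : ℤ) ∣ s then zeta N else 0)
    (c α : ℕ → ℂ) (a b : ℕ → ℤ) {ε : ℤ} (hε : Odd ε)
    (h : universalExt N D x = ∑ m ∈ Finset.range N, ∑ n ∈ Finset.range (4 * N),
      ∑ j ∈ Finset.range (4 * N), quadCoeff N (c m) (α m) (a m) (b m) ε n j •
        (M m * ((kUnit N ^ (n + j + 4 : ℤ) : (ExtQG N)ˣ) : ExtQG N))) :
    psiPhi N D x = zeta N * ∑ n ∈ Finset.range (4 * N),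
      quadCoeff N (c (N - 1)) (α (N - 1)) (a (N - 1)) (b (N - 1)) ε n (-n - 4) := by
  have hN0 : N ≠ 0 := by omega
  rw [psiPhi_eq hN, h]
  · simp only [Finset.mul_sum, map_sum, mul_smul_comm, map_smul]
    rw [Finset.sum_eq_single (N - 1)]
    · refine Finset.sum_congr rfl fun n _ => ?_
      have hp : Function.Periodic (fun j : ℤ => zeta N *
          quadCoeff N (c (N - 1)) (α (N - 1)) (a (N - 1)) (b (N - 1)) ε n j)
          ((4 * N : ℕ) : ℤ) := fun j => by
        simp only
        rw [quadCoeff_periodic_right hN0]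
      rw [← sum_range_periodic_ite (by omega : 4 * N ≠ 0) hp (-n - 4)]
      refine Finset.sum_congr rfl fun j _ => ?_
      have e : (j : ℤ) - (-n - 4) = n + j + 4 := by ring
      rw [hint _ (by omega), e]
      simp only [true_and]
      split_ifs
      · rw [smul_eq_mul, mul_comm]
      · rw [smul_zero]
    · intro m hm hne
      refine Finset.sum_eq_zero fun n _ => Finset.sum_eq_zero fun j _ => ?_
      rw [hint m (Finset.mem_range.1 hm), if_neg (fun h => hne h.1), smul_zero]
    · intro h
      exact absurd (Finset.mem_range.2 (by omega)) h
  · rw [h]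
    exact sum_mem fun m _ => sum_quadCoeff_mem_range_incl hN0 (hM m) _ _ _ _ hε

theorem extIntegral_e_pow_f_pow {N : ℕ} (hN : 2 ≤ N) (m : ℕ) (s : ℤ) :
    extIntegral hN (((kUnit N ^ (2 * N + 2 : ℤ) : (ExtQG N)ˣ) : ExtQG N) *
      (ExtQG.gen N .E ^ m * ExtQG.gen N .F ^ m * ((kUnit N ^ s : (ExtQG N)ˣ) : ExtQG N))) =
      if m = N - 1 ∧ ((4 * N : ℕ) : ℤ) ∣ s then zeta N else 0 := by
  have h := extIntegral_e_first hN (2 * N + 2) 0 s m m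
  rw [zpow_zero, Units.val_one, mul_one, Int.cast_zero, zero_mul, neg_zero, qPow_zero, mul_one,
    add_zero, add_sub_cancel_left] at h
  simpa only [mul_assoc, and_self_left] using h

theorem extIntegral_f_pow_e_pow {N : ℕ} (hN : 2 ≤ N) {m : ℕ} (hm : m < N) (s : ℤ) :
    extIntegral hN (((kUnit N ^ (2 * N + 2 : ℤ) : (ExtQG N)ˣ) : ExtQG N) *
      (ExtQG.gen N .F ^ m * ExtQG.gen N .E ^ m * ((kUnit N ^ s : (ExtQG N)ˣ) : ExtQG N))) =
      if m = N - 1 ∧ ((4 * N : ℕ) : ℤ) ∣ s then zeta N else 0 := by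
  have h := extIntegral_f_first hN (2 * N + 2) 0 s hm
  rw [zpow_zero, Units.val_one, mul_one, Int.cast_zero, zero_mul, qPow_zero, mul_one,
    add_zero, add_sub_cancel_left] at h
  simpa only [mul_assoc] using h

/-- Completing the square in the exponents that remain in `ψ_φ`. -/
theorem sum_qPow_sq {N : ℕ} (hN : 2 ≤ N) :
    ∑ n ∈ Finset.range (4 * N), qPow N ((n : ℂ) ^ 2 / 2 + ((N - 1 : ℕ) + 2) * n +
      2 * (N - 1 : ℕ) + (N - 1 : ℕ) * ((N - 1 : ℕ) - 1) / 2) =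
      qPow N (-(N / 2)) * qPow N (-3 / 2) * quadraticGaussSum N := by
  have hp : Function.Periodic (fun n : ℤ => qPow N ((n : ℂ) ^ 2 / 2)) ((4 * N : ℕ) : ℤ) :=
    fun n => qPow_congr (by omega) (2 * n + 4 * N) (by push_cast; ring)
  have h := sum_range_periodic_add hp (N + 1)
  simp only [Int.cast_natCast] at h
  rw [quadraticGaussSum, ← h, Finset.mul_sum]
  refine Finset.sum_congr rfl fun n _ => ?_
  rw [← qPow_add, ← qPow_add]
  congr 1
  push_cast [Nat.cast_sub (show 1 ≤ N by omega)]
  ring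

theorem conj_qPow_div_two (N : ℕ) (z : ℤ) :
    (starRingEnd ℂ) (qPow N (z / 2)) = qPow N (-(z / 2)) := by
  have := conj_qPow N (z / 2)
  push_cast at this
  exact this

theorem sum_qPow_neg_sq {N : ℕ} (hN : 2 ≤ N) :
    ∑ n ∈ Finset.range (4 * N), qPow N (-((n : ℂ) ^ 2 / 2 + ((N - 1 : ℕ) + 2) * n +
      2 * (N - 1 : ℕ) + (N - 1 : ℕ) * ((N - 1 : ℕ) - 1) / 2)) =
      (starRingEnd ℂ) (qPow N (-(N / 2)) * qPow N (-3 / 2) * quadraticGaussSum N) := by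
  rw [← sum_qPow_sq hN, map_sum]
  refine Finset.sum_congr rfl fun n _ => ?_
  have h := conj_qPow_div_two N ((n : ℤ) ^ 2 + 2 * ((N - 1 : ℕ) + 2) * n + 4 * (N - 1 : ℕ) +
    (N - 1 : ℕ) * ((N - 1 : ℕ) - 1))
  have e : (((n : ℤ) ^ 2 + 2 * ((N - 1 : ℕ) + 2) * n + 4 * (N - 1 : ℕ) +
      (N - 1 : ℕ) * ((N - 1 : ℕ) - 1) : ℤ) : ℂ) / 2 = (n : ℂ) ^ 2 / 2 + ((N - 1 : ℕ) + 2) * n +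
      2 * (N - 1 : ℕ) + (N - 1 : ℕ) * ((N - 1 : ℕ) - 1) / 2 := by
    push_cast
    ring
  rw [e] at h
  exact h.symm

/-- The factor in front of the Gauss sum, from `{1}^(N-1) [N-1]! = i^(N-1) N`. -/
theorem zeta_mul_eq {N : ℕ} (hN : 2 ≤ N) :
    zeta N * (1 / (4 * N) * (brace N 1 ^ (N - 1) / qFactorial N (N - 1))) =
      -(Complex.I ^ (N - 1) / (2 * (Real.sqrt (2 * N) : ℂ))) := by
  have h0 : qFactorial N (N - 1) ≠ 0 := qFactorial_ne_zero hN (by omega)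
  have hN' : (N : ℂ) ≠ 0 := by
    have : N ≠ 0 := by omega
    exact_mod_cast this
  have hs : Real.sqrt (2 / N) = 2 / Real.sqrt (2 * N) := by
    have hpos : (0 : ℝ) < N := by
      have : 0 < N := by omega
      exact_mod_cast this
    rw [show (2 : ℝ) / N = 4 / (2 * N) by field_simp; norm_num,
      Real.sqrt_div (by norm_num), show (4 : ℝ) = 2 ^ 2 by norm_num, Real.sqrt_sq (by norm_num)]
  have hs0 : (Real.sqrt (2 * N) : ℂ) ≠ 0 := by
    have : (0 : ℝ) < 2 * N := by
      have : 0 < N := by omega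
      have : (0 : ℝ) < N := by exact_mod_cast this
      linarith
    exact_mod_cast (Real.sqrt_pos.2 this).ne'
  have hb : brace N 1 ^ (N - 1) * qFactorial N (N - 1) = Complex.I ^ (N - 1) * N := by
    rw [brace_pow_mul_qFactorial hN, prod_brace (by omega)]
  have e : zeta N * (1 / (4 * N) * (brace N 1 ^ (N - 1) / qFactorial N (N - 1))) =
      -(Real.sqrt (2 / N) : ℂ) / (4 * N) * (brace N 1 ^ (N - 1) * qFactorial N (N - 1)) := by
    rw [zeta]
    field_simp
  rw [e, hb, hs]
  push_cast
  field_simp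
  norm_num

theorem psiPhi_unknot_true_of_sum {N : ℕ} (hN : 2 ≤ N) {p : ℂ}
    (h : p = zeta N * ∑ n ∈ Finset.range (4 * N),
      1 / (4 * N) * (brace N 1 ^ (N - 1) / qFactorial N (N - 1)) *
        qPow N ((n : ℂ) ^ 2 / 2 + ((N - 1 : ℕ) + 2) * n +
      2 * (N - 1 : ℕ) + (N - 1 : ℕ) * ((N - 1 : ℕ) - 1) / 2)) :
    p = Complex.I ^ N * qPow N (-3 / 2) * quadraticGaussSum N /
      (2 * (Real.sqrt (2 * N) : ℂ)) := by
  have hI : Complex.I ^ N = Complex.I ^ (N - 1) * Complex.I := by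
    rw [← pow_succ, Nat.sub_add_cancel (by omega)]
  rw [h, ← Finset.mul_sum, ← mul_assoc, zeta_mul_eq hN, sum_qPow_sq hN,
    qPow_neg_half_self (by omega), hI]
  ring

theorem psiPhi_unknot_false_of_sum {N : ℕ} (hN : 2 ≤ N) {p : ℂ}
    (h : p = zeta N * ∑ n ∈ Finset.range (4 * N),
      1 / (4 * N) * ((-1) ^ (N - 1) * brace N 1 ^ (N - 1) / qFactorial N (N - 1)) *
        qPow N (-((n : ℂ) ^ 2 / 2 + ((N - 1 : ℕ) + 2) * n +
      2 * (N - 1 : ℕ) + (N - 1 : ℕ) * ((N - 1 : ℕ) - 1) / 2))) :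
    p = (starRingEnd ℂ) (Complex.I ^ N * qPow N (-3 / 2) * quadraticGaussSum N /
      (2 * (Real.sqrt (2 * N) : ℂ))) := by
  have hI : Complex.I ^ N = Complex.I ^ (N - 1) * Complex.I := by
    rw [← pow_succ, Nat.sub_add_cancel (by omega)]
  have e : zeta N * (1 / (4 * N) *
      ((-1) ^ (N - 1) * brace N 1 ^ (N - 1) / qFactorial N (N - 1))) =
      -((-Complex.I) ^ (N - 1) / (2 * (Real.sqrt (2 * N) : ℂ))) := by
    rw [← neg_one_mul Complex.I, mul_pow, mul_div_assoc, mul_div_assoc, ← mul_neg, ← zeta_mul_eq hN]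
    ring
  rw [h, ← Finset.mul_sum, ← mul_assoc, e, sum_qPow_neg_sq hN,
    qPow_neg_half_self (by omega), hI]
  simp only [map_div₀, map_mul, map_pow, map_neg, Complex.conj_I, Complex.conj_ofReal, map_ofNat]
  ring

theorem psiPhi_unknot_true {N : ℕ} (hN : 2 ≤ N) (x : Fin 2) :
    psiPhi N (unknot true) x = Complex.I ^ N * qPow N (-3 / 2) * quadraticGaussSum N /
      (2 * (Real.sqrt (2 * N) : ℂ)) := by
  have hN0 : N ≠ 0 := by omega
  refine psiPhi_unknot_true_of_sum hN ?_
  have hu : universalExt N (unknot true) x =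
      walkProduct N (unknot true) x (place N 1 0 1 (tensorSum N (rCoeff N))) := by
    rw [universalExt, braidInvariant_unknot, if_pos rfl, rMatrix_eq_tensorSum]
  fin_cases x
  · rw [psiPhi_eq_sum hN _ _
      (fun m => mul_mem (pow_mem (f_mem_range_incl N) m) (pow_mem (e_mem_range_incl N) m))
      (fun m hm => extIntegral_f_pow_e_pow hN hm)
      (fun m => 1 / (4 * N) * (brace N 1 ^ m / qFactorial N m))
      (fun m => (m : ℂ) * (m - 1) / 2 + 2 * m) (fun m => m) (fun m => 0) (ε := -1) (by decide)]
    · congr 1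
      refine Finset.sum_congr rfl fun n _ => ?_
      rw [quadCoeff]
      congr 2
      push_cast
      ring
    · refine (hu.trans (walkProduct_tensorSum_under_first hN0 true 0 _)).trans ?_
      refine Finset.sum_congr rfl fun m _ => Finset.sum_congr rfl fun n _ =>
        Finset.sum_congr rfl fun j _ => ?_
      congr 1
      rw [rCoeff, quadCoeff, ← mul_assoc, mul_assoc, ← qPow_add]
      congr 2
      push_cast
      ring
  · rw [psiPhi_eq_sum hN _ _
      (fun m => mul_mem (pow_mem (e_mem_range_incl N) m) (pow_mem (f_mem_range_incl N) m))
      (fun m _ => extIntegral_e_pow_f_pow hN m)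
      (fun m => 1 / (4 * N) * (brace N 1 ^ m / qFactorial N m))
      (fun m => (m : ℂ) * (m - 1) / 2 - 2 * m) (fun m => 0) (fun m => -m) (ε := -1) (by decide)]
    · congr 1
      refine Finset.sum_congr rfl fun n _ => ?_
      rw [quadCoeff]
      congr 2
      push_cast
      ring
    · refine (hu.trans (walkProduct_tensorSum_over_first hN0 true 1 _)).trans ?_
      refine Finset.sum_congr rfl fun m _ => Finset.sum_congr rfl fun n _ =>
        Finset.sum_congr rfl fun j _ => ?_
      congr 1
      rw [rCoeff, quadCoeff, ← mul_assoc, mul_assoc, ← qPow_add]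
      congr 2
      push_cast
      ring

theorem psiPhi_unknot_false {N : ℕ} (hN : 2 ≤ N) (x : Fin 2) :
    psiPhi N (unknot false) x = (starRingEnd ℂ) (Complex.I ^ N * qPow N (-3 / 2) *
      quadraticGaussSum N / (2 * (Real.sqrt (2 * N) : ℂ))) := by
  have hN0 : N ≠ 0 := by omega
  refine psiPhi_unknot_false_of_sum hN ?_
  have hu : universalExt N (unknot false) x =
      walkProduct N (unknot false) x (place N 1 1 0 (tensorSum N (rInvCoeff N))) := by
    rw [universalExt, braidInvariant_unknot, if_neg Bool.false_ne_true,
      rMatrixInv_eq_tensorSum hN0]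
  fin_cases x
  · rw [psiPhi_eq_sum hN _ _
      (fun m => mul_mem (pow_mem (e_mem_range_incl N) m) (pow_mem (f_mem_range_incl N) m))
      (fun m _ => extIntegral_e_pow_f_pow hN m)
      (fun m => 1 / (4 * N) * ((-1) ^ m * brace N 1 ^ m / qFactorial N m))
      (fun m => -((m : ℂ) * (m - 1) / 2) - 2 * m) (fun m => -m) (fun m => 0) (ε := 1) (by decide)]
    · congr 1
      refine Finset.sum_congr rfl fun n _ => ?_
      rw [quadCoeff]
      congr 2
      push_cast
      ring
    · refine (hu.trans (walkProduct_tensorSum_over_first hN0 false 0 _)).trans ?_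
      refine Finset.sum_congr rfl fun m _ => Finset.sum_congr rfl fun n _ =>
        Finset.sum_congr rfl fun j _ => ?_
      congr 1
      rw [rInvCoeff, quadCoeff, ← mul_assoc, mul_assoc, ← qPow_add]
      congr 2
      push_cast
      ring
  · rw [psiPhi_eq_sum hN _ _
      (fun m => mul_mem (pow_mem (f_mem_range_incl N) m) (pow_mem (e_mem_range_incl N) m))
      (fun m hm => extIntegral_f_pow_e_pow hN hm)
      (fun m => 1 / (4 * N) * ((-1) ^ m * brace N 1 ^ m / qFactorial N m))
      (fun m => -((m : ℂ) * (m - 1) / 2) + 2 * m) (fun m => 0) (fun m => m) (ε := 1) (by decide)]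
    · congr 1
      refine Finset.sum_congr rfl fun n _ => ?_
      rw [quadCoeff]
      congr 2
      push_cast
      ring
    · refine (hu.trans (walkProduct_tensorSum_under_first hN0 false 1 _)).trans ?_
      refine Finset.sum_congr rfl fun m _ => Finset.sum_congr rfl fun n _ =>
        Finset.sum_congr rfl fun j _ => ?_
      congr 1
      rw [rInvCoeff, quadCoeff, ← mul_assoc, mul_assoc, ← qPow_add]
      congr 2
      push_cast
      ring

/-! ### The quadratic Gauss sum -/

open Filter Topology in
theorem tendsto_cosKernel_atTop (a : UnitAddCircle) :
    Tendsto (fun t => (HurwitzZeta.cosKernel a t : ℂ)) atTop (𝓝 1) := by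
  obtain ⟨p, hp, h⟩ := HurwitzZeta.isBigO_atTop_cosKernel_sub a
  have h0 : Tendsto (fun t : ℝ => Real.exp (-p * t)) atTop (𝓝 0) :=
    Real.tendsto_exp_atBot.comp (tendsto_id.const_mul_atTop_of_neg (neg_neg_of_pos hp))
  have h1 := (h.trans_tendsto h0).add_const 1
  simp only [sub_add_cancel, zero_add] at h1
  exact_mod_cast (Complex.continuous_ofReal.tendsto 1).comp h1

open Filter Topology in
theorem tendsto_jacobiTheta_atTop (x : ℝ) :
    Tendsto (fun t : ℝ => jacobiTheta (Complex.I * t + x)) atTop (𝓝 1) := by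
  have h : Tendsto (fun t : ℝ => Complex.I * t + (x : ℂ)) atTop (comap Complex.im atTop) := by
    refine tendsto_comap_iff.2 ?_
    have : (Complex.im ∘ fun t : ℝ => Complex.I * t + (x : ℂ)) = id := by
      ext t
      simp
    rw [this]
    exact tendsto_id
  have h0 : Tendsto (fun t : ℝ => Real.exp (-Real.pi * t)) atTop (𝓝 0) :=
    Real.tendsto_exp_atBot.comp (tendsto_id.const_mul_atTop_of_neg (neg_neg_of_pos Real.pi_pos))
  have h1 := isBigO_at_im_infty_jacobiTheta_sub_one.comp_tendsto h
  have e : ((fun τ : ℂ => Real.exp (-Real.pi * τ.im)) ∘ fun t : ℝ => Complex.I * t + (x : ℂ)) =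
      fun t : ℝ => Real.exp (-Real.pi * t) := by
    ext t
    simp
  rw [e] at h1
  have h2 := (h1.trans_tendsto h0).add_const 1
  simpa [Function.comp_def] using h2

theorem jacobiTheta_neg_inv {τ : ℂ} (hτ : 0 < τ.im) :
    jacobiTheta (-1 / τ) = (-Complex.I * τ) ^ (1 / 2 : ℂ) * jacobiTheta τ := by
  have h0 : τ ≠ 0 := by
    rintro rfl
    simp at hτ
  have h1 : (-Complex.I * τ) ^ (1 / 2 : ℂ) ≠ 0 := by
    rw [Ne, Complex.cpow_eq_zero_iff, not_and_or]
    exact Or.inl (mul_ne_zero (neg_ne_zero.mpr Complex.I_ne_zero) h0)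
  have h := jacobiTheta₂_functional_equation 0 τ
  rw [jacobiTheta_eq_jacobiTheta₂, jacobiTheta_eq_jacobiTheta₂, h]
  simp only [ne_eq, OfNat.ofNat_ne_zero, not_false_eq_true, zero_pow, mul_zero, zero_div,
    Complex.exp_zero, mul_one]
  field_simp

/-- The theta series on the vertical line over `1 / (2 N)` decomposes, according to the residue
class of the summation index modulo `2 N`, into the Gauss sum weighted with Hurwitz kernels. -/
theorem jacobiTheta_eq_sum_cosKernel {N : ℕ} (hN : N ≠ 0) {t : ℝ} (ht : 0 < t) :
    jacobiTheta (1 / (2 * N) + Complex.I / (4 * N ^ 2 * t)) = (Real.sqrt t : ℂ) *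
      ∑ r : Fin (2 * N), qPow N ((r : ℂ) ^ 2 / 2) *
        (HurwitzZeta.cosKernel (((r : ℝ) / (2 * N) : ℝ) : UnitAddCircle) t : ℂ) := by
  have hNC : (N : ℂ) ≠ 0 := by exact_mod_cast hN
  have htC : (t : ℂ) ≠ 0 := by exact_mod_cast ht.ne'
  have hNR : (N : ℝ) ≠ 0 := by exact_mod_cast hN
  have : NeZero (2 * N) := ⟨by omega⟩
  have him : 0 < (1 / (2 * N) + Complex.I / (4 * N ^ 2 * t) : ℂ).im := by
    have e : (1 / (2 * N) + Complex.I / (4 * N ^ 2 * t) : ℂ) =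
        ((1 / (2 * N) : ℝ) : ℂ) + ((1 / (4 * N ^ 2 * t) : ℝ) : ℂ) * Complex.I := by
      push_cast
      field_simp
    have h : (1 / (2 * N) + Complex.I / (4 * N ^ 2 * t) : ℂ).im = 1 / (4 * N ^ 2 * t) := by
      rw [e, Complex.add_im, Complex.ofReal_im, Complex.im_ofReal_mul, Complex.I_im, zero_add,
        mul_one]
    rw [h]
    positivity
  have hθ := hasSum_jacobiTheta₂_term 0 him
  rw [← jacobiTheta_eq_jacobiTheta₂,
    ← ((Equiv.prodComm _ _).trans (Int.divModEquiv (2 * N)).symm).hasSum_iff] at hθ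
  have hterm : ∀ (r : Fin (2 * N)) (m : ℤ), jacobiTheta₂_term
      (((Equiv.prodComm _ _).trans (Int.divModEquiv (2 * N)).symm) (r, m)) 0
        (1 / (2 * N) + Complex.I / (4 * N ^ 2 * t)) = qPow N ((r : ℂ) ^ 2 / 2) *
        (Real.exp (-Real.pi * (m + (r : ℝ) / (2 * N)) ^ 2 * (1 / t)) : ℂ) := by
    intro r m
    have hn : ((Equiv.prodComm _ _).trans (Int.divModEquiv (2 * N)).symm) (r, m) =
        m * (2 * N : ℕ) + (r : ℕ) := rfl
    have hq : qPow N ((r : ℂ) ^ 2 / 2) = qPow N (((m * (2 * N : ℕ) + (r : ℕ) : ℤ) : ℂ) ^ 2 / 2) :=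
      (qPow_congr hN (m ^ 2 * N + m * r) (by push_cast; ring)).symm
    rw [hn, jacobiTheta₂_term, hq, qPow, Complex.ofReal_exp, ← Complex.exp_add]
    congr 1
    push_cast
    field_simp
    linear_combination 4 * ((m : ℂ) * (2 * N) + r) ^ 2 * Complex.I_sq
  have hfib := hθ.prod_fiberwise fun r => by
    have h := HurwitzZeta.hasSum_int_evenKernel ((r : ℝ) / (2 * N)) (one_div_pos.2 ht)
    have h' := (Complex.hasSum_ofReal.2 h).mul_left (qPow N ((r : ℂ) ^ 2 / 2))
    simp only [← hterm] at h'
    exact h'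
  rw [hfib.unique (hasSum_fintype _), Finset.mul_sum]
  refine Finset.sum_congr rfl fun r _ => ?_
  rw [HurwitzZeta.evenKernel_functional_equation, one_div_one_div, Real.sqrt_eq_rpow,
    Real.div_rpow zero_le_one ht.le, Real.one_rpow, one_div_one_div]
  push_cast
  ring

theorem jacobiTheta_two_mul_natCast_add (n : ℕ) (τ : ℂ) :
    jacobiTheta (2 * n + τ) = jacobiTheta τ := by
  induction n with
  | zero => simp
  | succ n ih =>
    rw [← ih, ← jacobiTheta_two_add (2 * n + τ)]
    congr 1
    push_cast
    ring

theorem ofReal_mul_cpow_half {t : ℝ} (ht : 0 < t) {z : ℂ} (hz : z ≠ 0) :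
    (t * z) ^ (1 / 2 : ℂ) = (Real.sqrt t : ℂ) * z ^ (1 / 2 : ℂ) := by
  have htC : (t : ℂ) ≠ 0 := by exact_mod_cast ht.ne'
  rw [Complex.cpow_def_of_ne_zero (mul_ne_zero htC hz), Complex.cpow_def_of_ne_zero hz,
    Complex.log_ofReal_mul ht hz, add_mul, Complex.exp_add, Real.sqrt_eq_rpow,
    Complex.ofReal_cpow ht.le, Complex.cpow_def_of_ne_zero htC, Complex.ofReal_log ht.le]
  push_cast
  rfl

/-- Two applications of the functional equation of the theta function, with a translation by the
even integer `2 N` in between, relate its values near the cusp `1 / (2 N)` to those near `i ∞`. -/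
theorem cpow_mul_sum_cosKernel {N : ℕ} (hN : N ≠ 0) {t : ℝ} (ht : 0 < t) :
    (-Complex.I * (1 / (2 * N) + Complex.I / (4 * N ^ 2) * ((t⁻¹ : ℝ) : ℂ))) ^ (1 / 2 : ℂ) *
      ∑ r : Fin (2 * N), qPow N ((r : ℂ) ^ 2 / 2) *
        (HurwitzZeta.cosKernel (((r : ℝ) / (2 * N) : ℝ) : UnitAddCircle) t : ℂ) =
      (1 + Complex.I / (2 * N) * ((t⁻¹ : ℝ) : ℂ)) ^ (1 / 2 : ℂ) *
        jacobiTheta (Complex.I * t + ((-1 / (2 * N) : ℝ) : ℂ)) := by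
  have hNC : (N : ℂ) ≠ 0 := by exact_mod_cast hN
  have htC : (t : ℂ) ≠ 0 := by exact_mod_cast ht.ne'
  have hs : (Real.sqrt t : ℂ) ≠ 0 := by exact_mod_cast (Real.sqrt_pos.2 ht).ne'
  have hz : (1 + Complex.I / (2 * N) * ((t⁻¹ : ℝ) : ℂ) : ℂ) ≠ 0 := by
    intro h
    have := congrArg Complex.re h
    rw [show (Complex.I / (2 * N) * ((t⁻¹ : ℝ) : ℂ) : ℂ) =
      ((1 / (2 * N) * t⁻¹ : ℝ) : ℂ) * Complex.I by push_cast; ring] at this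
    simp at this
  have hτ : 0 < (1 / (2 * N) + Complex.I / (4 * N ^ 2 * t) : ℂ).im := by
    rw [show (1 / (2 * N) + Complex.I / (4 * N ^ 2 * t) : ℂ) =
        ((1 / (2 * N) : ℝ) : ℂ) + ((1 / (4 * N ^ 2 * t) : ℝ) : ℂ) * Complex.I by
      push_cast
      field_simp, Complex.add_im, Complex.ofReal_im, Complex.im_ofReal_mul, Complex.I_im, zero_add,
        mul_one]
    positivity
  have hσ : 0 < (Complex.I * t + ((-1 / (2 * N) : ℝ) : ℂ)).im := by
    rw [Complex.add_im, Complex.ofReal_im]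
    simpa using ht
  have h1 := jacobiTheta_neg_inv hτ
  have h2 := jacobiTheta_neg_inv hσ
  have hden : (2 * N * t + Complex.I : ℂ) ≠ 0 := by
    intro h
    have := congrArg Complex.im h
    rw [show (2 * N * t + Complex.I : ℂ) = ((2 * N * t : ℝ) : ℂ) + Complex.I by push_cast; rfl]
      at this
    simp at this
  have e1 : (1 / (2 * N) + Complex.I / (4 * N ^ 2 * t) : ℂ) =
      (2 * N * t + Complex.I) / (4 * N ^ 2 * t) := by
    field_simp
    ring
  have e2 : (Complex.I * t + ((-1 / (2 * N) : ℝ) : ℂ)) =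
      Complex.I * (2 * N * t + Complex.I) / (2 * N) := by
    push_cast
    field_simp
    linear_combination -Complex.I_sq
  have e3 : (-1 / (Complex.I * t + ((-1 / (2 * N) : ℝ) : ℂ)) : ℂ) =
      2 * N + -1 / (1 / (2 * N) + Complex.I / (4 * N ^ 2 * t)) := by
    rw [e1, e2]
    have hI := Complex.I_ne_zero
    field_simp
    linear_combination -(2 : ℂ) * Complex.I_sq
  have e4 : -Complex.I * (Complex.I * t + ((-1 / (2 * N) : ℝ) : ℂ)) =
      t * (1 + Complex.I / (2 * N) * ((t⁻¹ : ℝ) : ℂ)) := by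
    push_cast
    field_simp
    linear_combination -(2 : ℂ) * N * t * Complex.I_sq
  have e5 : (Complex.I / (4 * N ^ 2 * t) : ℂ) = Complex.I / (4 * N ^ 2) * ((t⁻¹ : ℝ) : ℂ) := by
    push_cast
    field_simp
  rw [e3, jacobiTheta_two_mul_natCast_add, h1, jacobiTheta_eq_sum_cosKernel hN ht, e4,
    ofReal_mul_cpow_half ht hz, e5, mul_left_comm, mul_assoc] at h2
  exact mul_left_cancel₀ hs h2

open Filter Topology in
/-- The Gauss sum over half the period: the limit `t → ∞` of the transformation formula. -/
theorem sum_fin_qPow_sq {N : ℕ} (hN : N ≠ 0) :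
    ∑ r : Fin (2 * N), qPow N ((r : ℂ) ^ 2 / 2) = (1 + Complex.I) * (Real.sqrt N : ℂ) := by
  have hNC : (N : ℂ) ≠ 0 := by exact_mod_cast hN
  have hNR : (0 : ℝ) < N := by
    have : 0 < N := by omega
    exact_mod_cast this
  have hsN : (Real.sqrt N : ℂ) ≠ 0 := by exact_mod_cast (Real.sqrt_pos.2 hNR).ne'
  have hsq : (Real.sqrt N : ℂ) ^ 2 = N := by exact_mod_cast Real.sq_sqrt hNR.le
  have hinv : Tendsto (fun t : ℝ => ((t⁻¹ : ℝ) : ℂ)) atTop (𝓝 0) := by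
    exact_mod_cast (Complex.continuous_ofReal.tendsto 0).comp tendsto_inv_atTop_zero
  have hslit : (-Complex.I * (1 / (2 * N) + Complex.I / (4 * N ^ 2) * 0) : ℂ) ∈
      Complex.slitPlane := by
    rw [show (-Complex.I * (1 / (2 * N) + Complex.I / (4 * N ^ 2) * 0) : ℂ) =
      ((-(1 / (2 * N)) : ℝ) : ℂ) * Complex.I by push_cast; ring]
    refine Or.inr ?_
    rw [Complex.im_ofReal_mul, Complex.I_im, mul_one]
    exact neg_ne_zero.2 (by positivity)
  have l1 : Tendsto (fun t : ℝ =>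
      (-Complex.I * (1 / (2 * N) + Complex.I / (4 * N ^ 2) * ((t⁻¹ : ℝ) : ℂ))) ^ (1 / 2 : ℂ))
      atTop (𝓝 ((-Complex.I * (1 / (2 * N) + Complex.I / (4 * N ^ 2) * 0)) ^ (1 / 2 : ℂ))) :=
    (continuousAt_cpow_const hslit).tendsto.comp
      (((hinv.const_mul _).const_add _).const_mul _)
  have l2 : Tendsto (fun t : ℝ => ∑ r : Fin (2 * N), qPow N ((r : ℂ) ^ 2 / 2) *
        (HurwitzZeta.cosKernel (((r : ℝ) / (2 * N) : ℝ) : UnitAddCircle) t : ℂ))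
      atTop (𝓝 (∑ r : Fin (2 * N), qPow N ((r : ℂ) ^ 2 / 2) * 1)) :=
    tendsto_finsetSum _ fun r _ => (tendsto_cosKernel_atTop _).const_mul _
  have l3 : Tendsto (fun t : ℝ => (1 + Complex.I / (2 * N) * ((t⁻¹ : ℝ) : ℂ)) ^ (1 / 2 : ℂ))
      atTop (𝓝 ((1 + Complex.I / (2 * N) * 0) ^ (1 / 2 : ℂ))) :=
    (continuousAt_cpow_const (by simp)).tendsto.comp ((hinv.const_mul _).const_add _)
  have hlim := tendsto_nhds_unique_of_eventuallyEq (l1.mul l2)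
    (l3.mul (tendsto_jacobiTheta_atTop (-1 / (2 * N))))
    ((eventually_gt_atTop 0).mono fun t ht => cpow_mul_sum_cosKernel hN ht)
  -- the square root of `-i / (2 N)` with positive real part
  have hroot : (-Complex.I * (1 / (2 * N) + Complex.I / (4 * N ^ 2) * 0)) ^ (1 / 2 : ℂ) =
      (1 - Complex.I) / (2 * (Real.sqrt N : ℂ)) := by
    have hre : 0 < ((1 - Complex.I) / (2 * (Real.sqrt N : ℂ))).re := by
      rw [show (2 * (Real.sqrt N : ℂ)) = ((2 * Real.sqrt N : ℝ) : ℂ) by push_cast; rfl,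
        Complex.div_ofReal_re]
      simpa using hNR
    rw [one_div (2 : ℂ), ← Complex.sq_cpow_two_inv hre]
    congr 1
    rw [div_pow, mul_pow, hsq]
    field_simp
    linear_combination (-4 : ℂ) * N * Complex.I_sq
  rw [hroot] at hlim
  simp only [mul_one, mul_zero, add_zero, Complex.one_cpow] at hlim
  rw [div_mul_eq_mul_div, div_eq_iff (mul_ne_zero two_ne_zero hsN)] at hlim
  have h2 : (1 + Complex.I) * (1 - Complex.I) = 2 := by
    linear_combination -Complex.I_sq
  linear_combination (1 + Complex.I) / 2 * hlim -
    (∑ r : Fin (2 * N), qPow N ((r : ℂ) ^ 2 / 2)) / 2 * h2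

/-- The Gauss sum runs over two periods of `j ↦ q^(j²/2)`. -/
theorem quadraticGaussSum_eq {N : ℕ} (hN : N ≠ 0) :
    quadraticGaussSum N = 2 * (1 + Complex.I) * (Real.sqrt N : ℂ) := by
  have h := sum_fin_qPow_sq hN
  rw [Fin.sum_univ_eq_sum_range (fun r : ℕ => qPow N ((r : ℂ) ^ 2 / 2))] at h
  rw [quadraticGaussSum, show 4 * N = 2 * N + 2 * N by ring, Finset.sum_range_add, h]
  have e : ∀ r : ℕ, qPow N (((2 * N + r : ℕ) : ℂ) ^ 2 / 2) = qPow N ((r : ℂ) ^ 2 / 2) := fun r =>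
    qPow_congr hN (N + r) (by push_cast; ring)
  simp only [e, h]
  ring

theorem norm_unknot_value {N : ℕ} (hN : N ≠ 0) :
    ‖Complex.I ^ N * qPow N (-3 / 2) * quadraticGaussSum N /
      (2 * (Real.sqrt (2 * N) : ℂ))‖ = 1 := by
  have hNR : (0 : ℝ) < N := by
    have : 0 < N := by omega
    exact_mod_cast this
  have hq : ‖qPow N (-3 / 2)‖ = 1 := by
    have := norm_qPow N (-3 / 2)
    push_cast at this
    exact this
  have h1 : ‖(1 + Complex.I : ℂ)‖ = Real.sqrt 2 := by
    rw [Complex.norm_def]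
    norm_num [Complex.normSq_apply]
  have hs : Real.sqrt N ≠ 0 := (Real.sqrt_pos.2 hNR).ne'
  rw [quadraticGaussSum_eq hN, norm_div, norm_mul, norm_mul, norm_pow, Complex.norm_I, one_pow, hq,
    norm_mul, norm_mul, norm_mul, h1, Complex.norm_real, Complex.norm_real,
    Real.norm_of_nonneg (Real.sqrt_nonneg _), Real.norm_of_nonneg (Real.sqrt_nonneg _),
    Real.sqrt_mul zero_le_two, Complex.norm_two]
  field_simp

end HenningsNormalization

open HenningsNormalization in
theorem lemma4 (N : ℕ) (hN : 2 ≤ N) :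
    (∀ (s : Bool) (x : Fin 2),
      ‖psiPhi N (unknot s) x‖ = 1 ∧ psiPhi N (unknot s) x ≠ 0) ∧
    quadraticGaussSum N = 2 * (1 + Complex.I) * (Real.sqrt N : ℂ) ∧
    (∀ x : Fin 2,
      psiPhi N (unknot true) x =
        Complex.I ^ N * qPow N (-3 / 2) * quadraticGaussSum N / (2 * (Real.sqrt (2 * N) : ℂ))) ∧
    (∀ x : Fin 2,
      psiPhi N (unknot false) x =
        (starRingEnd ℂ)
          (Complex.I ^ N * qPow N (-3 / 2) * quadraticGaussSum N / (2 * (Real.sqrt (2 * N) : ℂ)))) := by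
  have hN0 : N ≠ 0 := by omega
  have hnorm : ∀ (s : Bool) (x : Fin 2), ‖psiPhi N (unknot s) x‖ = 1 := by
    intro s x
    cases s
    · rw [psiPhi_unknot_false hN, RCLike.norm_conj, norm_unknot_value hN0]
    · rw [psiPhi_unknot_true hN, norm_unknot_value hN0]
  refine ⟨fun s x => ⟨hnorm s x, fun h => ?_⟩, quadraticGaussSum_eq hN0, psiPhi_unknot_true hN,
    psiPhi_unknot_false hN⟩
  have := hnorm s x
  rw [h, norm_zero] at this
  exact zero_ne_one this
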